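/- Let $R,L>0$, let $f\in\mathcal S(\mathbb R^2)$ be a (complex-valued) Schwartz function and let $$g(x,r)=\frac1{|S^1|}\int_{S^1}f(x+r\xi,r\eta)\,dS_1(\xi,\eta)\qquad(x,r\in\mathbb R)$$ be its spherical Radon transform. Put $J_0(z)=\sum_{k\ge0}(-1)^k\frac{z^{2k}}{2^{2k}k!\,\Gamma(k+1)}$, $\varepsilon_0=1$ and $\varepsilon_l=2$ for $l\ge1$. Define - $o_{range}^{a,b}(x,r)=\delta(x-a)\,\frac{\cos(b\sqrt{r^2-R^2})}{\sqrt{r^2-R^2}}$ for $r>R$ and $0$ otherwise ($a\in\mathbb R$, $b\ge0$); - $o_{even}^{a,l}(x,r)=J_0(a\sqrt{x^2-L^2})\,\frac{\cos(l\frac{\pi}{R}\sqrt{R^2-r^2})}{\sqrt{R^2-r^2}}$ for $0\le r<R$, $|x|>L$ and $0$ otherwise, and $o_{odd}^{a,l}(x,r)=x\,o_{even}^{a,l}(x,r)$ ($a\ge0$, $l\in\mathbb N_0$); $$G_{range}(a,b)=\frac2\pi\int_R^\infty\!\int_{\mathbb R}o_{range}^{a,b}(x,r)\,g(x,r)\,r\sqrt{r^2-R^2}\,dx\,dr,$$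 $$G_{even}^l(a)=\frac{\varepsilon_l}{2R}\,a\int_0^R\!\int_L^\infty o_{even}^{a,l}(x,r)\,(g(x,r)+g(-x,r))\,r\sqrt{R^2-r^2}\,x\,dx\,dr,$$ $$G_{odd}^l(a)=\frac{\varepsilon_l}{2R}\,a\int_0^R\!\int_L^\infty o_{odd}^{a,l}(x,r)\,(g(x,r)-g(-x,r))\,r\sqrt{R^2-r^2}\,\frac1x\,dx\,dr.$$ Here $\delta(x-a)\,dx$ denotes the unit point mass at $a$ and, below, $\delta(x-a)\,da$ the unit point mass at $x$. Then: 1. $G_{range}(a,b)$ is well defined (the integral converges absolutely) for all $a\in\mathbb R$, $b\ge0$, and for all $x\in\mathbb R$, $r>R$, $$g(x,r)=\int_0^\infty\!\int_{\mathbb R}o_{range}^{a,b}(x,r)\,G_{range}(a,b)\,da\,db .$$ 2. $G_{even}^l(a)$ is well defined (the double integral converges absolutely) for all $l\in\mathbb N_0$, $a\ge0$, and for $0<r<R$, $|x|>L$, $$\frac{g(x,r)+g(-x,r)}2=\sum_{l=0}^\infty\int_0^\infty o_{even}^{a,l}(x,r)\,G_{even}^l(a)\,da ;$$ in particular the right-hand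 side is $g(x,r)$ if $g$ is even in $x$. 3. $G_{odd}^l(a)$ is well defined (the double integral converges absolutely) for all $l\in\mathbb N_0$, $a\ge0$, and for $0<r<R$, $|x|>L$, $$\frac{g(x,r)-g(-x,r)}2=\sum_{l=0}^\infty\int_0^\infty o_{odd}^{a,l}(x,r)\,G_{odd}^l(a)\,da ;$$ in particular the right-hand side is $g(x,r)$ if $g$ is odd in $x$. The outer $b$-integral in 1, the $a$-integrals and the series in 2 and 3 all converge absolutely. -/

import Mathlib

open MeasureTheory Set

namespace SAR

noncomputable section

/-- The canonical surface (arc length) measure `S_1` on the unit circle `S^1 ⊆ ℝ²`. -/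
def circleMeasure : Measure (Metric.sphere (0 : EuclideanSpace ℝ (Fin 2)) 1) :=
  (volume : Measure (EuclideanSpace ℝ (Fin 2))).toSphere

/-- The spherical Radon transform in the plane,
`Rf(x,r) = |S^1|⁻¹ ∫_{S^1} f(x + r ξ, r η) dS_1(ξ,η)`. -/
def sphericalRadon (f : SchwartzMap (EuclideanSpace ℝ (Fin 2)) ℂ) (x r : ℝ) : ℂ :=
  ((circleMeasure.real univ)⁻¹ : ℝ) •
    ∫ ω : Metric.sphere (0 : EuclideanSpace ℝ (Fin 2)) 1,
      f !₂[x + r * (ω : EuclideanSpace ℝ (Fin 2)) 0, r * (ω : EuclideanSpace ℝ (Fin 2)) 1]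
      ∂circleMeasure

/-- The Bessel function of order zero, by its power series. -/
def besselJ0 (z : ℝ) : ℝ :=
  ∑' k : ℕ, (-1 : ℝ) ^ k * (z ^ (2 * k) / (2 ^ (2 * k) * (k.factorial : ℝ) * Real.Gamma (k + 1)))

/-- Neumann's number: `ε_0 = 1` and `ε_n = 2` for `n ≥ 1`. -/
def neumannNumber (n : ℕ) : ℝ := if n = 0 then 1 else 2

/-! The distribution `o_range^{a,b}(x,r) = δ(x-a) · k_b(r)`. -/

/-- The factor of `o_range^{a,b}` that depends on `r`:
`k_b(r) = cos(b √(r²-R²)) / √(r²-R²)` for `r > R`, and `0` otherwise. -/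
def oRangeRadial (R b r : ℝ) : ℝ :=
  if R < r then Real.cos (b * √(r ^ 2 - R ^ 2)) / √(r ^ 2 - R ^ 2) else 0

/-- The inner integral `∫_ℝ o_range^{a,b}(x,r) v(x,r) r √(r²-R²) dx` of the scalar product.
As a function of `x`, `δ(x-a) dx` is the unit point mass at `a`. -/
def oRangeInnerIntegrand (R a b : ℝ) (v : ℝ → ℝ → ℂ) (r : ℝ) : ℂ :=
  ∫ x, (oRangeRadial R b r : ℂ) * v x r * ((r * √(r ^ 2 - R ^ 2) : ℝ) : ℂ) ∂(Measure.dirac a)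

/-- The scalar product
`<o_range^{a,b}, v>_{o_range} = ∫_R^∞ ∫_ℝ o_range^{a,b}(x,r) v(x,r) r √(r²-R²) dx dr`. -/
def oRangeInner (R a b : ℝ) (v : ℝ → ℝ → ℂ) : ℂ :=
  ∫ r in Ioi R, oRangeInnerIntegrand R a b v r

/-- The projection `G_range(a,b)` of the data `g`. -/
def GRange (R : ℝ) (g : ℝ → ℝ → ℂ) (a b : ℝ) : ℂ :=
  ((2 / Real.pi : ℝ) : ℂ) * oRangeInner R a b g

/-- The inner integral `∫_ℝ o_range^{a,b}(x,r) G(a,b) da` of a superposition of the `o_range^{a,b}`.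
As a function of `a`, `δ(x-a) da` is the unit point mass at `x`. -/
def oRangeSuperposition (R : ℝ) (G : ℝ → ℝ → ℂ) (x r b : ℝ) : ℂ :=
  ∫ a, (oRangeRadial R b r : ℂ) * G a b ∂(Measure.dirac x)

/-! The functions `o_even^{a,l}` and `o_odd^{a,l}`. -/

/-- `o_even^{a,l}(x,r) = J_0(a √(x²-L²)) cos(l π/R √(R²-r²)) / √(R²-r²)` for `0 ≤ r < R` and
`|x| > L`, and `0` otherwise. -/
def oEven (R L a : ℝ) (l : ℕ) (x r : ℝ) : ℝ :=
  if (0 ≤ r ∧ r < R) ∧ L < |x| then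
    besselJ0 (a * √(x ^ 2 - L ^ 2)) *
      (Real.cos (l * (Real.pi / R) * √(R ^ 2 - r ^ 2)) / √(R ^ 2 - r ^ 2))
  else 0

/-- `o_odd^{a,l}(x,r) = x J_0(a √(x²-L²)) cos(l π/R √(R²-r²)) / √(R²-r²)` for `0 ≤ r < R` and
`|x| > L`, and `0` otherwise. -/
def oOdd (R L a : ℝ) (l : ℕ) (x r : ℝ) : ℝ :=
  if (0 ≤ r ∧ r < R) ∧ L < |x| then
    x * besselJ0 (a * √(x ^ 2 - L ^ 2)) *
      (Real.cos (l * (Real.pi / R) * √(R ^ 2 - r ^ 2)) / √(R ^ 2 - r ^ 2))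
  else 0

/-- The integrand `u(x,r) v(x,r) r √(R²-r²) x` of `<u,v>_{o_even}`. -/
def oEvenInnerIntegrand (R : ℝ) (u : ℝ → ℝ → ℝ) (v : ℝ → ℝ → ℂ) (x r : ℝ) : ℂ :=
  (u x r : ℂ) * v x r * ((r * √(R ^ 2 - r ^ 2) * x : ℝ) : ℂ)

/-- `<u,v>_{o_even} = ∫_0^R ∫_L^∞ u(x,r) v(x,r) r √(R²-r²) x dx dr`. -/
def oEvenInner (R L : ℝ) (u : ℝ → ℝ → ℝ) (v : ℝ → ℝ → ℂ) : ℂ :=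
  ∫ r in Ioo 0 R, ∫ x in Ioi L, oEvenInnerIntegrand R u v x r

/-- The integrand `u(x,r) v(x,r) r √(R²-r²) x⁻¹` of `<u,v>_{o_odd}`. -/
def oOddInnerIntegrand (R : ℝ) (u : ℝ → ℝ → ℝ) (v : ℝ → ℝ → ℂ) (x r : ℝ) : ℂ :=
  (u x r : ℂ) * v x r * ((r * √(R ^ 2 - r ^ 2) * (1 / x) : ℝ) : ℂ)

/-- `<u,v>_{o_odd} = ∫_0^R ∫_L^∞ u(x,r) v(x,r) r √(R²-r²) x⁻¹ dx dr`. -/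
def oOddInner (R L : ℝ) (u : ℝ → ℝ → ℝ) (v : ℝ → ℝ → ℂ) : ℂ :=
  ∫ r in Ioo 0 R, ∫ x in Ioi L, oOddInnerIntegrand R u v x r

/-- The projection `G_even^l(a)` of the data `g`. -/
def GEven (R L : ℝ) (g : ℝ → ℝ → ℂ) (l : ℕ) (a : ℝ) : ℂ :=
  ((neumannNumber l / (2 * R) * a : ℝ) : ℂ) *
    oEvenInner R L (oEven R L a l) (fun x r => g x r + g (-x) r)

/-- The projection `G_odd^l(a)` of the data `g`. -/
def GOdd (R L : ℝ) (g : ℝ → ℝ → ℂ) (l : ℕ) (a : ℝ) : ℂ :=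
  ((neumannNumber l / (2 * R) * a : ℝ) : ℂ) *
    oOddInner R L (oOdd R L a l) (fun x r => g x r - g (-x) r)

end

end SAR

/-! ### Averages of families of Schwartz functions on the line -/

namespace SAR

open scoped SchwartzMap ContDiff Topology

/-! The square roots in the kernels are changes of variables. After them, each projection is a
classical transform of a regular function, and each reconstruction formula is the inversion formula
of that transform.

For `r > R` put `s = √(r² - R²)`. At fixed `x`, `G_range(x,·)` is `2/π` times the cosine transform
of `q(s) = s g(x, √(s² + R²))` on the half line (`exists_GRange_eq_cosTransform`), and
`cosTransform_inversion`, divided by `s`, returns `g`.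

For `r < R` and `|x| > L` put `t = √(R² - r²)` and `y = √(x² - L²)`. With `v(x,r) = g(x,r) ±
g(-x,r)`, the `r`-integration produces the Fourier cosine coefficients `D` of `t v(x, √(R² - t²))`
on `(0,R)`; the `x`-integration produces the order-zero Hankel transform in `y` of `D` (even case)
or of `D/x` (odd case), see `integral_kernel`. Conversely, the integral over `a` undoes the Hankel
transform for each `l` (`hankel_expansion`), and the sum over `l` is then a cosine series at fixed
`x` (`hasSum_radial_cosine_series`). Sum and integral never have to be interchanged.

Hankel inversion is Fourier inversion for radial Schwartz functions of the plane. It applies because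
`L > 0` makes `z ↦ D(√(‖z‖² + L²))` smooth at the origin (`radialLift`). The cosine series converges
absolutely because `t v(x, √(R² - t²))` has bounded derivative: `g` is even in `r`, so its
`r`-derivative vanishes at `r = 0` and compensates the singularity of the square root at `t = R`.
The regularity of `g` comes from differentiation under the integral over the circle
(`exists_schwartz_integral`). -/

theorem iteratedFDeriv_lineRestrict_bound {E : Type*} [NormedAddCommGroup E] [NormedSpace ℝ E]
    (f : 𝓢(E, ℂ)) (M : ℝ) (k n : ℕ) :
    ∃ C, ∀ p v : E, ‖p‖ ≤ M → ‖v‖ = 1 → ∀ u : ℝ,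
      ‖u‖ ^ k * ‖iteratedFDeriv ℝ n (fun u : ℝ => f (p + u • v)) u‖ ≤ C := by
  obtain ⟨C₁, hC₁⟩ := f.decay' k n
  obtain ⟨C₂, hC₂⟩ := f.decay' 0 n
  refine ⟨2 ^ k * (C₁ + M ^ k * C₂), fun p v hp hv u => ?_⟩
  have hM : 0 ≤ M := (norm_nonneg p).trans hp
  let A : ℝ →L[ℝ] E := (ContinuousLinearMap.id ℝ ℝ).smulRight v
  have hA : ‖A‖ ≤ 1 := A.opNorm_le_bound zero_le_one fun x => by simp [A, norm_smul, hv]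
  have hf : ContDiff ℝ ∞ (fun y => f (p + y)) := (f.smooth ⊤).comp (contDiff_const.add contDiff_id)
  have h1 : iteratedFDeriv ℝ n (fun u : ℝ => f (p + u • v)) u =
      (iteratedFDeriv ℝ n f (p + u • v)).compContinuousLinearMap fun _ => A := by
    have := A.iteratedFDeriv_comp_right hf u (i := n) (by exact_mod_cast le_top)
    rw [iteratedFDeriv_comp_add_left] at this
    exact this
  have h2 : ‖iteratedFDeriv ℝ n (fun u : ℝ => f (p + u • v)) u‖ ≤
      ‖iteratedFDeriv ℝ n f (p + u • v)‖ := by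
    rw [h1]
    refine (ContinuousMultilinearMap.norm_compContinuousLinearMap_le _ _).trans ?_
    refine mul_le_of_le_one_right (norm_nonneg _) ?_
    exact Finset.prod_le_one (fun _ _ => norm_nonneg _) (fun _ _ => hA)
  -- This turns decay in the ambient space into decay along the line, uniformly for base points in
  -- the ball of radius `M`.
  have h3 : ‖u‖ ≤ ‖p + u • v‖ + M := by
    have : ‖u • v‖ ≤ ‖p + u • v‖ + ‖p‖ := by
      simpa using norm_sub_le (p + u • v) p
    rw [norm_smul, hv, mul_one] at this
    linarith
  set D := ‖iteratedFDeriv ℝ n f (p + u • v)‖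
  have hD : 0 ≤ D := norm_nonneg _
  have h4 : ‖p + u • v‖ ^ k * D ≤ C₁ := hC₁ _
  have h5 : D ≤ C₂ := le_trans (by simp [D]; rfl) (hC₂ (p + u • v))
  calc ‖u‖ ^ k * ‖iteratedFDeriv ℝ n (fun u : ℝ => f (p + u • v)) u‖
      ≤ (‖p + u • v‖ + M) ^ k * D := by gcongr
    _ ≤ (2 ^ (k - 1) * (‖p + u • v‖ ^ k + M ^ k)) * D := by
        gcongr
        exact add_pow_le (norm_nonneg _) hM k
    _ ≤ (2 ^ k * (‖p + u • v‖ ^ k + M ^ k)) * D := by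
        gcongr
        · norm_num
        · omega
    _ = 2 ^ k * (‖p + u • v‖ ^ k * D + M ^ k * D) := by ring
    _ ≤ _ := by gcongr

/-- The restriction of a Schwartz function to the line through `p` with unit direction `v`. -/
noncomputable def lineRestrict {E : Type*} [NormedAddCommGroup E] [NormedSpace ℝ E]
    (f : 𝓢(E, ℂ)) (p v : E) (hv : ‖v‖ = 1) : 𝓢(ℝ, ℂ) where
  toFun u := f (p + u • v)
  smooth' := (f.smooth ⊤).comp (contDiff_const.add (contDiff_id.smul contDiff_const))
  decay' k n := by
    obtain ⟨C, hC⟩ := iteratedFDeriv_lineRestrict_bound f ‖p‖ k n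
    exact ⟨C, fun u => hC p v le_rfl hv u⟩

theorem lineRestrict_apply {E : Type*} [NormedAddCommGroup E] [NormedSpace ℝ E]
    (f : 𝓢(E, ℂ)) (p v : E) (hv : ‖v‖ = 1) (u : ℝ) :
    lineRestrict f p v hv u = f (p + u • v) := rfl

theorem seminorm_lineRestrict_bound {E : Type*} [NormedAddCommGroup E] [NormedSpace ℝ E]
    (f : 𝓢(E, ℂ)) (M : ℝ) (k n : ℕ) :
    ∃ C, ∀ (p v : E) (hv : ‖v‖ = 1), ‖p‖ ≤ M →
      SchwartzMap.seminorm ℝ k n (lineRestrict f p v hv) ≤ C := by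
  obtain ⟨C, hC⟩ := iteratedFDeriv_lineRestrict_bound f M k n
  refine ⟨max C 0, fun p v hv hp => ?_⟩
  exact SchwartzMap.seminorm_le_bound ℝ k n _ (le_max_right _ _)
    fun u => (hC p v hp hv u).trans (le_max_left _ _)

theorem seminorm_deriv_le (k n : ℕ) (F : 𝓢(ℝ, ℂ)) :
    SchwartzMap.seminorm ℝ k n (SchwartzMap.derivCLM ℝ ℂ F) ≤ SchwartzMap.seminorm ℝ k (n + 1) F := by
  refine SchwartzMap.seminorm_le_bound' ℝ k n _ (apply_nonneg _ _) fun u => ?_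
  have h : (SchwartzMap.derivCLM ℝ ℂ F : ℝ → ℂ) = deriv F := by
    ext; simp
  rw [h, ← iteratedDeriv_succ']
  exact SchwartzMap.le_seminorm' ℝ k (n + 1) F u

theorem norm_le_seminorm_zero (F : 𝓢(ℝ, ℂ)) (u : ℝ) :
    ‖F u‖ ≤ SchwartzMap.seminorm ℝ 0 0 F := SchwartzMap.norm_le_seminorm ℝ F u

/-- A derivative is the pointwise limit of the difference quotients with steps `1/(n+1)`, and each
quotient is measurable in the parameter. -/
theorem aestronglyMeasurable_deriv_family {X : Type*} [MeasurableSpace X] {μ : Measure X}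
    (F : X → 𝓢(ℝ, ℂ)) (hF : ∀ u, AEStronglyMeasurable (fun x => F x u) μ) (u : ℝ) :
    AEStronglyMeasurable (fun x => SchwartzMap.derivCLM ℝ ℂ (F x) u) μ := by
  have ht : Filter.Tendsto (fun n : ℕ => (1 : ℝ) / (n + 1)) Filter.atTop (𝓝[≠] 0) := by
    rw [tendsto_nhdsWithin_iff]
    exact ⟨tendsto_one_div_add_atTop_nhds_zero_nat,
      Filter.Eventually.of_forall fun n => by simp; positivity⟩
  refine aestronglyMeasurable_of_tendsto_ae Filter.atTop
    (f := fun (n : ℕ) x => ((1 : ℝ) / (n + 1))⁻¹ • (F x (u + 1 / (n + 1)) - F x u)) (fun n => ?_)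
    (Filter.Eventually.of_forall fun x => ?_)
  · exact AEStronglyMeasurable.const_smul ((hF _).sub (hF _)) (((1 : ℝ) / (n + 1))⁻¹)
  · have h := ((F x).differentiable (x := u)).hasDerivAt.tendsto_slope_zero
    have h' := h.comp ht
    simpa [Function.comp_def] using h'

theorem hasDerivAt_integral_schwartz_family {X : Type*} [MeasurableSpace X] {μ : Measure X}
    [IsFiniteMeasure μ] (F : X → 𝓢(ℝ, ℂ)) (hF : ∀ u, AEStronglyMeasurable (fun x => F x u) μ)
    (hb : ∀ k n, ∃ C, ∀ x, SchwartzMap.seminorm ℝ k n (F x) ≤ C) (u : ℝ) :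
    HasDerivAt (fun u => ∫ x, F x u ∂μ) (∫ x, SchwartzMap.derivCLM ℝ ℂ (F x) u ∂μ) u := by
  obtain ⟨C₀, hC₀⟩ := hb 0 0
  obtain ⟨C₁, hC₁⟩ := hb 0 1
  refine (hasDerivAt_integral_of_dominated_loc_of_deriv_le (s := univ) (bound := fun _ => C₁)
    (F' := fun u x => SchwartzMap.derivCLM ℝ ℂ (F x) u)
    Filter.univ_mem (Filter.Eventually.of_forall hF) ?_
    (aestronglyMeasurable_deriv_family F hF u) ?_ (integrable_const _) ?_).2
  · exact Integrable.of_bound (hF u) C₀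
      (Filter.Eventually.of_forall fun x => (norm_le_seminorm_zero _ _).trans (hC₀ x))
  · exact Filter.Eventually.of_forall fun x u _ =>
      ((norm_le_seminorm_zero _ _).trans (seminorm_deriv_le 0 0 _)).trans (hC₁ x)
  · refine Filter.Eventually.of_forall fun x u _ => ?_
    simpa using ((F x).differentiable (x := u)).hasDerivAt

/-- Induction over all families at once: the family of derivatives is again measurable and has
uniformly bounded seminorms, so one differentiation under the integral reduces `n + 1` to `n`. -/
theorem iteratedDeriv_integral_schwartz_family {X : Type*} [MeasurableSpace X] {μ : Measure X}
    [IsFiniteMeasure μ] (n : ℕ) (F : X → 𝓢(ℝ, ℂ))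
    (hF : ∀ u, AEStronglyMeasurable (fun x => F x u) μ)
    (hb : ∀ k n, ∃ C, ∀ x, SchwartzMap.seminorm ℝ k n (F x) ≤ C) :
    Differentiable ℝ (iteratedDeriv n fun u => ∫ x, F x u ∂μ) ∧
      iteratedDeriv n (fun u => ∫ x, F x u ∂μ) = fun u => ∫ x, iteratedDeriv n (F x) u ∂μ := by
  induction n generalizing F with
  | zero =>
    simp only [iteratedDeriv_zero, and_true]
    exact fun u => (hasDerivAt_integral_schwartz_family F hF hb u).differentiableAt
  | succ n ih =>
    have hd : deriv (fun u => ∫ x, F x u ∂μ) = fun u => ∫ x, SchwartzMap.derivCLM ℝ ℂ (F x) u ∂μ :=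
      funext fun u => (hasDerivAt_integral_schwartz_family F hF hb u).deriv
    have hb' : ∀ k n, ∃ C, ∀ x, SchwartzMap.seminorm ℝ k n (SchwartzMap.derivCLM ℝ ℂ (F x)) ≤ C := by
      intro k n
      obtain ⟨C, hC⟩ := hb k (n + 1)
      exact ⟨C, fun x => (seminorm_deriv_le k n _).trans (hC x)⟩
    have h := ih (fun x => SchwartzMap.derivCLM ℝ ℂ (F x))
      (aestronglyMeasurable_deriv_family F hF) hb'
    rw [iteratedDeriv_succ', hd]
    refine ⟨h.1, h.2.trans ?_⟩
    ext u
    congr 1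
    ext x
    rw [iteratedDeriv_succ']
    congr 2

/-- The average of a bounded measurable family of Schwartz functions is a Schwartz function. -/
theorem exists_schwartz_integral {X : Type*} [MeasurableSpace X] (μ : Measure X)
    [IsFiniteMeasure μ] (F : X → 𝓢(ℝ, ℂ)) (hF : ∀ u, AEStronglyMeasurable (fun x => F x u) μ)
    (hb : ∀ k n, ∃ C, ∀ x, SchwartzMap.seminorm ℝ k n (F x) ≤ C) :
    ∃ Φ : 𝓢(ℝ, ℂ), ∀ u, Φ u = ∫ x, F x u ∂μ := by
  refine ⟨⟨fun u => ∫ x, F x u ∂μ, ?_, ?_⟩, fun u => rfl⟩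
  · exact contDiff_of_differentiable_iteratedDeriv fun m _ =>
      (iteratedDeriv_integral_schwartz_family m F hF hb).1
  · intro k n
    obtain ⟨C, hC⟩ := hb k n
    refine ⟨C * μ.real univ, fun u => ?_⟩
    rw [norm_iteratedFDeriv_eq_norm_iteratedDeriv,
      (iteratedDeriv_integral_schwartz_family n F hF hb).2, ← norm_pow]
    calc ‖u ^ k‖ * ‖∫ x, iteratedDeriv n (F x) u ∂μ‖
        = ‖∫ x, (u ^ k) • iteratedDeriv n (F x) u ∂μ‖ := by rw [integral_smul, norm_smul]
      _ ≤ C * μ.real univ := by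
        refine norm_integral_le_of_norm_le_const (Filter.Eventually.of_forall fun x => ?_)
        rw [norm_smul, norm_pow]
        exact (SchwartzMap.le_seminorm' ℝ k n (F x) u).trans (hC x)

end SAR

/-! ### The cosine transform on the half line -/

namespace SAR

open scoped SchwartzMap Topology FourierTransform

theorem integrable_ofReal_cos_mul {μ : Measure ℝ} {K : ℝ → ℂ} (hK : Integrable K μ) (c : ℝ) :
    Integrable (fun s => (Real.cos (c * s) : ℂ) * K s) μ := by
  refine hK.bdd_mul (c := 1) (Continuous.aestronglyMeasurable (by fun_prop)) ?_
  refine Filter.Eventually.of_forall fun s => ?_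
  rw [Complex.norm_real]
  exact Real.abs_cos_le_one _

/-- The Fourier transform of an even function is twice its cosine transform. -/
theorem fourier_of_even {K : ℝ → ℂ} (hK : Integrable K) (he : ∀ s, K (-s) = K s) (w : ℝ) :
    𝓕 K w = 2 * ∫ s in Ioi (0 : ℝ), (Real.cos (2 * Real.pi * w * s) : ℂ) * K s := by
  have hi : Integrable fun v : ℝ => Complex.exp (↑(-2 * Real.pi * v * w) * Complex.I) • K v := by
    refine hK.bdd_mul (c := 1) (Continuous.aestronglyMeasurable (by fun_prop)) ?_
    exact Filter.Eventually.of_forall fun s => (Complex.norm_exp_ofReal_mul_I _).le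
  rw [Real.fourier_real_eq_integral_exp_smul, ← intervalIntegral.integral_Iic_add_Ioi (b := 0)
    hi.integrableOn hi.integrableOn]
  have h := integral_comp_neg_Ioi 0
    (fun v : ℝ => Complex.exp (↑(-2 * Real.pi * v * w) * Complex.I) • K v)
  rw [neg_zero] at h
  rw [← h, ← integral_add, ← integral_const_mul]
  · congr 1
    ext s
    rw [he, ← add_smul, Complex.ofReal_cos, Complex.cos, smul_eq_mul]
    push_cast
    have e1 : (-2 * Real.pi * -s * w : ℂ) * Complex.I = 2 * Real.pi * w * s * Complex.I := by ring
    have e2 : (-2 * Real.pi * s * w : ℂ) * Complex.I = -(2 * Real.pi * w * s) * Complex.I := by ring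
    rw [e1, e2]
    ring
  · have := hi.comp_neg
    exact this.integrableOn
  · exact hi.integrableOn

/-- The cosine transform of the restriction of `q` to the half line. -/
noncomputable def cosTransform (q : ℝ → ℂ) (b : ℝ) : ℂ :=
  ∫ s in Ioi (0 : ℝ), (Real.cos (b * s) : ℂ) * q s

theorem continuous_cosTransform {q : ℝ → ℂ} (hq : IntegrableOn q (Ioi 0)) :
    Continuous (cosTransform q) := by
  refine continuous_of_dominated (bound := fun s => ‖q s‖)
    (fun b => (integrable_ofReal_cos_mul hq b).aestronglyMeasurable) (fun b => ?_) hq.norm ?_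
  · refine Filter.Eventually.of_forall fun s => ?_
    rw [norm_mul, Complex.norm_real]
    exact mul_le_of_le_one_left (norm_nonneg _) (Real.abs_cos_le_one _)
  · exact Filter.Eventually.of_forall fun s => by fun_prop

theorem norm_cosTransform_le {q : ℝ → ℂ} (hq : IntegrableOn q (Ioi 0)) (b : ℝ) :
    ‖cosTransform q b‖ ≤ ∫ s in Ioi (0 : ℝ), ‖q s‖ := by
  refine norm_integral_le_of_norm_le hq.norm (Filter.Eventually.of_forall fun s => ?_)
  rw [norm_mul, Complex.norm_real]
  exact mul_le_of_le_one_left (norm_nonneg _) (Real.abs_cos_le_one _)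

/-- Two integrations by parts, carried out with a single primitive. At the origin the sine term
vanishes and only the term with the derivative survives. This yields decay of order `b⁻²`, hence
integrability in `b`. -/
theorem sq_mul_cosTransform (q : 𝓢(ℝ, ℂ)) (b : ℝ) :
    (b : ℂ) ^ 2 * cosTransform q b = - deriv q 0 -
      cosTransform (SchwartzMap.derivCLM ℝ ℂ (SchwartzMap.derivCLM ℝ ℂ q)) b := by
  set q₁ := SchwartzMap.derivCLM ℝ ℂ q with hq₁
  set q₂ := SchwartzMap.derivCLM ℝ ℂ q₁ with hq₂
  have hd0 : ∀ s, HasDerivAt q (q₁ s) s := fun s => by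
    simpa [hq₁] using (q.differentiable (x := s)).hasDerivAt
  have hd1 : ∀ s, HasDerivAt q₁ (q₂ s) s := fun s => by
    simpa [hq₂] using (q₁.differentiable (x := s)).hasDerivAt
  have hsin : ∀ s : ℝ, HasDerivAt (fun s : ℝ => (Real.sin (b * s) : ℂ)) (Real.cos (b * s) * b) s :=
    fun s => by
      have := ((hasDerivAt_id s).const_mul b).sin.ofReal_comp
      simpa using this
  have hcos : ∀ s : ℝ, HasDerivAt (fun s : ℝ => (Real.cos (b * s) : ℂ)) (-Real.sin (b * s) * b) s :=
    fun s => by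
      have := ((hasDerivAt_id s).const_mul b).cos.ofReal_comp
      simpa using this
  have hd : ∀ s ∈ Ici (0 : ℝ), HasDerivAt
      (fun s => (b : ℂ) * ((Real.sin (b * s) : ℂ) * q s) + (Real.cos (b * s) : ℂ) * q₁ s)
      ((b : ℂ) ^ 2 * ((Real.cos (b * s) : ℂ) * q s) + (Real.cos (b * s) : ℂ) * q₂ s) s := by
    intro s _
    refine ((((hsin s).mul (hd0 s)).const_mul (b : ℂ)).add ((hcos s).mul (hd1 s))).congr_deriv ?_
    ring
  have hi : ∀ φ : 𝓢(ℝ, ℂ), IntegrableOn (fun s => (Real.cos (b * s) : ℂ) * φ s) (Ioi 0) :=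
    fun φ => integrable_ofReal_cos_mul φ.integrable.integrableOn b
  have hz : ∀ (φ : 𝓢(ℝ, ℂ)) (w : ℝ → ℝ), (∀ s, |w s| ≤ 1) →
      Filter.Tendsto (fun s => (w s : ℂ) * φ s) Filter.atTop (𝓝 0) := by
    intro φ w hw
    have h0 : Filter.Tendsto (fun s => ‖φ s‖) Filter.atTop (𝓝 0) := by
      have := (φ.tendsto_cocompact).mono_left (atTop_le_cocompact (α := ℝ))
      simpa using this.norm
    refine squeeze_zero_norm (fun s => ?_) h0
    rw [norm_mul, Complex.norm_real]
    exact mul_le_of_le_one_left (norm_nonneg _) (hw s)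
  have ht : Filter.Tendsto
      (fun s => (b : ℂ) * ((Real.sin (b * s) : ℂ) * q s) + (Real.cos (b * s) : ℂ) * q₁ s)
      Filter.atTop (𝓝 0) := by
    have := ((hz q (fun s => Real.sin (b * s)) fun s => Real.abs_sin_le_one _).const_mul
      (b : ℂ)).add (hz q₁ (fun s => Real.cos (b * s)) fun s => Real.abs_cos_le_one _)
    simpa using this
  have := integral_Ioi_of_hasDerivAt_of_tendsto' hd (((hi q).const_mul _).add (hi q₂)) ht
  rw [integral_add ((hi q).const_mul _) (hi q₂), integral_const_mul] at this
  have e : q₁ 0 = deriv q 0 := by simp [hq₁]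
  simp only [mul_zero, Real.sin_zero, Real.cos_zero, Complex.ofReal_zero, Complex.ofReal_one,
    zero_mul, one_mul, zero_add, zero_sub, e] at this
  rw [cosTransform, cosTransform]
  linear_combination this

theorem exists_norm_cosTransform_le (q : 𝓢(ℝ, ℂ)) :
    ∃ C, ∀ b, ‖cosTransform q b‖ ≤ C * (1 + b ^ 2)⁻¹ := by
  set q₂ := SchwartzMap.derivCLM ℝ ℂ (SchwartzMap.derivCLM ℝ ℂ q) with hq₂
  have h0 := norm_cosTransform_le (q := q) q.integrable.integrableOn
  have h2 := norm_cosTransform_le (q := q₂) q₂.integrable.integrableOn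
  set A := ∫ s in Ioi (0 : ℝ), ‖q s‖
  set B := ∫ s in Ioi (0 : ℝ), ‖q₂ s‖
  refine ⟨A + (‖deriv q 0‖ + B), fun b => ?_⟩
  have hpos : (0 : ℝ) < 1 + b ^ 2 := by positivity
  rw [← div_eq_mul_inv, le_div_iff₀ hpos]
  have h3 : b ^ 2 * ‖cosTransform q b‖ ≤ ‖deriv q 0‖ + B := by
    have h := congrArg norm (sq_mul_cosTransform q b)
    rw [norm_mul, norm_pow, Complex.norm_real, Real.norm_eq_abs, sq_abs] at h
    rw [h]
    refine (norm_sub_le _ _).trans ?_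
    rw [norm_neg]
    gcongr
    exact h2 b
  nlinarith [h0 b]

theorem integrable_cosTransform (q : 𝓢(ℝ, ℂ)) : Integrable (cosTransform q) := by
  obtain ⟨C, hC⟩ := exists_norm_cosTransform_le q
  exact (integrable_inv_one_add_sq.const_mul C).mono'
    (continuous_cosTransform q.integrable.integrableOn).aestronglyMeasurable
    (Filter.Eventually.of_forall hC)

/-- Inversion of the cosine transform on the half line. -/
theorem cosTransform_inversion (q : 𝓢(ℝ, ℂ)) {t : ℝ} (ht : 0 ≤ t) :
    q t = (2 / Real.pi : ℝ) * ∫ b in Ioi (0 : ℝ), (Real.cos (b * t) : ℂ) * cosTransform q b := by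
  -- The even extension may have a corner at the origin, so it need not be Schwartz. The inversion
  -- theorem used is the one for continuous integrable functions with integrable Fourier transform.
  set K : ℝ → ℂ := fun s => q |s| with hKdef
  have hKc : Continuous K := q.continuous.comp continuous_abs
  have he : ∀ s, K (-s) = K s := fun s => by simp [K]
  have hKi : Integrable K := by
    refine ((q.integrable (μ := volume)).norm.add q.integrable.comp_neg.norm).mono'
      hKc.aestronglyMeasurable (Filter.Eventually.of_forall fun s => ?_)
    simp only [K, Pi.add_apply]
    rcases abs_choice s with h | h <;> rw [h] <;> simp
  have hF : ∀ w, 𝓕 K w = 2 * cosTransform q (2 * Real.pi * w) := by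
    intro w
    rw [fourier_of_even hKi he, cosTransform]
    congr 1
    refine setIntegral_congr_fun measurableSet_Ioi fun s hs => ?_
    simp only [K, abs_of_pos (mem_Ioi.1 hs)]
  have hpi : (0 : ℝ) < 2 * Real.pi := by positivity
  have hF' : 𝓕 K = fun w => 2 * cosTransform q (2 * Real.pi * w) := funext hF
  have hFi : Integrable (𝓕 K) := by
    rw [hF']
    exact ((integrable_cosTransform q).comp_mul_left' hpi.ne').const_mul 2
  have hFe : ∀ w, 𝓕 K (-w) = 𝓕 K w := by
    intro w
    rw [hF, hF, cosTransform, cosTransform]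
    simp
  have hinv := congrFun (hKc.fourierInv_fourier_eq hKi hFi) t
  rw [Real.fourierInv_eq_fourier_neg, fourier_of_even hFi hFe] at hinv
  have h4 := integral_comp_mul_left_Ioi
    (fun b => (Real.cos (b * t) : ℂ) * cosTransform q b) 0 hpi
  have h5 : ∀ s : ℝ, (Real.cos (2 * Real.pi * -t * s) : ℂ) * 𝓕 K s =
      2 * ((Real.cos (2 * Real.pi * s * t) : ℂ) * cosTransform q (2 * Real.pi * s)) := by
    intro s
    rw [hF, show 2 * Real.pi * -t * s = -(2 * Real.pi * s * t) by ring, Real.cos_neg]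
    ring
  simp only [h5, integral_const_mul, h4, mul_zero] at hinv
  simp only [K, abs_of_nonneg ht] at hinv
  rw [← hinv, Complex.real_smul]
  have : (Real.pi : ℂ) ≠ 0 := by exact_mod_cast Real.pi_ne_zero
  generalize (∫ x in Ioi (0 : ℝ), (Real.cos (x * t) : ℂ) * cosTransform q x) = J
  push_cast
  field_simp

end SAR

/-! ### The Bessel function and the Hankel transform of order zero -/

namespace SAR

open scoped SchwartzMap Topology FourierTransform

theorem integral_sin_pow_even_eq_factorial (k : ℕ) :
    ∫ θ in (0 : ℝ)..Real.pi, Real.sin θ ^ (2 * k) =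
      Real.pi * ((2 * k).factorial / (2 ^ (2 * k) * (k.factorial : ℝ) ^ 2)) := by
  rw [integral_sin_pow_even]
  congr 1
  induction k with
  | zero => simp
  | succ k ih =>
    rw [Finset.prod_range_succ, ih, show 2 * (k + 1) = 2 * k + 1 + 1 by ring,
      Nat.factorial_succ, Nat.factorial_succ, Nat.factorial_succ]
    have : (k.factorial : ℝ) ≠ 0 := by positivity
    push_cast
    field_simp
    ring

/-- The integral representation of the Bessel function of order zero. -/
theorem integral_cos_mul_sin (z : ℝ) :
    ∫ θ in (0 : ℝ)..Real.pi, Real.cos (z * Real.sin θ) = Real.pi * besselJ0 z := by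
  have hs : HasSum (fun k : ℕ => ∫ θ in (0 : ℝ)..Real.pi,
      (-1) ^ k * (z * Real.sin θ) ^ (2 * k) / ((2 * k).factorial : ℝ))
      (∫ θ in (0 : ℝ)..Real.pi, Real.cos (z * Real.sin θ)) := by
    have hsum : Summable fun k : ℕ => |z| ^ (2 * k) / ((2 * k).factorial : ℝ) :=
      (Real.summable_pow_div_factorial |z|).comp_injective
        (mul_right_injective₀ (two_ne_zero (α := ℕ)))
    refine intervalIntegral.hasSum_integral_of_dominated_convergence
      (fun k _ => |z| ^ (2 * k) / ((2 * k).factorial : ℝ)) (fun k => ?_) (fun k => ?_) ?_ ?_ ?_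
    · exact Continuous.aestronglyMeasurable (by fun_prop)
    · refine Filter.Eventually.of_forall fun θ _ => ?_
      rw [norm_div, norm_mul, norm_pow, norm_neg, norm_one, one_pow, one_mul, norm_pow, norm_mul,
        Real.norm_eq_abs, Real.norm_eq_abs, Real.norm_natCast]
      gcongr
      exact mul_le_of_le_one_right (abs_nonneg _) (Real.abs_sin_le_one _)
    · exact Filter.Eventually.of_forall fun _ _ => hsum
    · exact intervalIntegrable_const
    · exact Filter.Eventually.of_forall fun θ _ => Real.hasSum_cos _
  rw [← hs.tsum_eq, besselJ0, ← tsum_mul_left]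
  congr 1
  ext k
  have h : ∀ θ : ℝ, (-1) ^ k * (z * Real.sin θ) ^ (2 * k) / ((2 * k).factorial : ℝ) =
      ((-1) ^ k * z ^ (2 * k) / ((2 * k).factorial : ℝ)) * Real.sin θ ^ (2 * k) := by
    intro θ; ring
  simp only [h, intervalIntegral.integral_const_mul, integral_sin_pow_even_eq_factorial,
    Real.Gamma_nat_eq_factorial]
  have h1 : (k.factorial : ℝ) ≠ 0 := by positivity
  have h2 : ((2 * k).factorial : ℝ) ≠ 0 := by positivity
  field_simp

theorem besselJ0_eq_integral (z : ℝ) :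
    besselJ0 z = Real.pi⁻¹ * ∫ θ in (0 : ℝ)..Real.pi, Real.cos (z * Real.sin θ) := by
  rw [integral_cos_mul_sin, inv_mul_cancel_left₀ Real.pi_ne_zero]

theorem continuous_besselJ0 : Continuous besselJ0 := by
  rw [show besselJ0 = _ from funext besselJ0_eq_integral]
  exact continuous_const.mul
    (intervalIntegral.continuous_parametric_intervalIntegral_of_continuous' (by fun_prop) _ _)

theorem abs_besselJ0_le_one (z : ℝ) : |besselJ0 z| ≤ 1 := by
  have h := intervalIntegral.norm_integral_le_of_norm_le_const (a := 0) (b := Real.pi) (C := 1)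
    (f := fun θ => Real.cos (z * Real.sin θ)) fun θ _ => Real.abs_cos_le_one _
  rw [integral_cos_mul_sin, norm_mul, Real.norm_eq_abs, Real.norm_eq_abs, sub_zero,
    abs_of_pos Real.pi_pos, one_mul] at h
  exact le_of_mul_le_mul_left (by simpa using h) Real.pi_pos

/-- This is the angular integral in the planar Fourier transform. Shifting by `π/2 - φ` turns the
cosine into a sine, periodicity restores the interval, and pairing `θ` with `-θ` leaves the integral
representation of `besselJ0`. -/
theorem integral_exp_mul_cos_sub (z φ : ℝ) :
    ∫ θ in (-Real.pi)..Real.pi, Complex.exp (((-z * Real.cos (θ - φ) : ℝ) : ℂ) * Complex.I) =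
      2 * Real.pi * besselJ0 z := by
  set E : ℝ → ℂ := fun θ => Complex.exp (((-z * Real.sin θ : ℝ) : ℂ) * Complex.I) with hE
  have hEc : Continuous E := by fun_prop
  have hper : Function.Periodic E (2 * Real.pi) := fun θ => by
    simp only [hE, Real.sin_add_two_pi]
  have h1 : ∀ θ : ℝ, Complex.exp (((-z * Real.cos (θ - φ) : ℝ) : ℂ) * Complex.I) =
      E (θ + (Real.pi / 2 - φ)) := by
    intro θ
    simp only [hE]
    rw [show θ + (Real.pi / 2 - φ) = (θ - φ) + Real.pi / 2 by ring, Real.sin_add_pi_div_two]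
  simp only [h1]
  rw [intervalIntegral.integral_comp_add_right,
    show Real.pi + (Real.pi / 2 - φ) = (-Real.pi + (Real.pi / 2 - φ)) + 2 * Real.pi by ring,
    hper.intervalIntegral_add_eq _ (-Real.pi), show -Real.pi + 2 * Real.pi = Real.pi by ring,
    ← intervalIntegral.integral_add_adjacent_intervals (b := 0) (hEc.intervalIntegrable _ _)
      (hEc.intervalIntegrable _ _)]
  have h2 : ∫ θ in (-Real.pi)..0, E θ = ∫ θ in (0 : ℝ)..Real.pi, E (-θ) := by
    rw [intervalIntegral.integral_comp_neg, neg_zero]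
  have hEn : Continuous fun θ => E (-θ) := hEc.comp continuous_neg
  rw [h2, ← intervalIntegral.integral_add (hEn.intervalIntegrable _ _) (hEc.intervalIntegrable _ _)]
  have h3 : ∀ θ : ℝ, E (-θ) + E θ = 2 * ((Real.cos (z * Real.sin θ) : ℝ) : ℂ) := by
    intro θ
    simp only [hE]
    rw [Complex.ofReal_cos, Complex.cos, Real.sin_neg]
    push_cast
    ring_nf
  simp only [h3, intervalIntegral.integral_const_mul, intervalIntegral.integral_ofReal,
    integral_cos_mul_sin]
  push_cast
  ring

/-- The Hankel transform of order zero. -/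
noncomputable def hankel (u : ℝ → ℂ) (a : ℝ) : ℂ :=
  ∫ y in Ioi (0 : ℝ), (y : ℂ) * ((besselJ0 (a * y) : ℂ) * u y)

theorem integrable_id_mul_schwartz (F : 𝓢(ℂ, ℂ)) :
    Integrable fun ρ : ℝ => (ρ : ℂ) * F (ρ : ℂ) := by
  have h := (lineRestrict F 0 1 norm_one).integrable_pow_mul volume 1
  refine h.mono' (Continuous.aestronglyMeasurable (by fun_prop)) ?_
  refine Filter.Eventually.of_forall fun ρ => ?_
  simp [lineRestrict_apply]

/-- The Fourier transform of a radial Schwartz function in the plane is its Hankel transform. -/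
theorem fourier_radial (F : 𝓢(ℂ, ℂ)) (hF : ∀ z, F z = F (‖z‖ : ℂ)) (w : ℂ) :
    𝓕 (F : ℂ → ℂ) w = 2 * Real.pi * hankel (fun ρ => F (ρ : ℂ)) (2 * Real.pi * ‖w‖) := by
  have hin : ∀ p : ℝ × ℝ, inner ℝ (Complex.polarCoord.symm p) w =
      p.1 * ‖w‖ * Real.cos (p.2 - Complex.arg w) := by
    intro p
    rw [Complex.polarCoord_symm_apply, Complex.inner, Real.cos_sub]
    rw [Complex.mul_re, Complex.conj_re, Complex.conj_im, ← Complex.norm_mul_cos_arg w,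
      ← Complex.norm_mul_sin_arg w]
    simp [-Complex.ofReal_cos, -Complex.ofReal_sin, -Complex.norm_mul_cos_arg,
      -Complex.norm_mul_sin_arg]
    ring
  have hint : ∀ p ∈ Ioi (0 : ℝ) ×ˢ Ioo (-Real.pi) Real.pi,
      p.1 • (Complex.exp ((↑(-2 * Real.pi * inner ℝ (Complex.polarCoord.symm p) w) * Complex.I)) •
        F (Complex.polarCoord.symm p)) =
      Complex.exp (((-(2 * Real.pi * ‖w‖ * p.1) * Real.cos (p.2 - Complex.arg w) : ℝ) : ℂ) *
        Complex.I) * ((p.1 : ℂ) * F (p.1 : ℂ)) := by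
    rintro p ⟨hp, -⟩
    rw [hin, hF (Complex.polarCoord.symm p), Complex.norm_polarCoord_symm,
      abs_of_pos (mem_Ioi.1 hp), Complex.real_smul, smul_eq_mul, mul_left_comm]
    congr 4
    ring
  rw [Real.fourier_eq', ← Complex.integral_comp_polarCoord_symm, polarCoord_target,
    setIntegral_congr_fun (measurableSet_Ioi.prod measurableSet_Ioo) hint, Measure.volume_eq_prod,
    setIntegral_prod]
  · rw [hankel, ← integral_const_mul]
    refine setIntegral_congr_fun measurableSet_Ioi fun ρ _ => ?_
    simp only
    rw [integral_mul_const, ← integral_Ioc_eq_integral_Ioo,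
      ← intervalIntegral.integral_of_le (by linarith [Real.pi_pos]), integral_exp_mul_cos_sub]
    ring
  · have h1 : IntegrableOn (fun ρ : ℝ => (ρ : ℂ) * F (ρ : ℂ)) (Ioi 0) :=
      (integrable_id_mul_schwartz F).integrableOn
    have h2 : IntegrableOn (fun _ : ℝ => (1 : ℂ)) (Ioo (-Real.pi) Real.pi) := by simp
    have h3 := Integrable.mul_prod (μ := volume.restrict (Ioi (0 : ℝ)))
      (ν := volume.restrict (Ioo (-Real.pi) Real.pi)) h1 h2
    rw [Measure.prod_restrict] at h3
    simp only [mul_one] at h3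
    refine h3.bdd_mul (c := 1) (Continuous.aestronglyMeasurable (by fun_prop)) ?_
    exact Filter.Eventually.of_forall fun s => (Complex.norm_exp_ofReal_mul_I _).le

/-- Allows `fourier_radial` to be applied a second time, to the Fourier transform itself. -/
theorem fourier_radial_radial (F : 𝓢(ℂ, ℂ)) (hF : ∀ z, F z = F (‖z‖ : ℂ)) (w : ℂ) :
    (𝓕 F : 𝓢(ℂ, ℂ)) w = (𝓕 F : 𝓢(ℂ, ℂ)) (‖w‖ : ℂ) := by
  rw [SchwartzMap.fourier_coe, fourier_radial F hF, fourier_radial F hF]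
  simp

/-- The factors `2π` come from the phase `exp(-2πi⟨z,w⟩)` and from the length of the circle. -/
theorem hankel_eq_fourier (F : 𝓢(ℂ, ℂ)) (hF : ∀ z, F z = F (‖z‖ : ℂ)) {a : ℝ} (ha : 0 ≤ a) :
    hankel (fun ρ => F (ρ : ℂ)) a =
      (2 * Real.pi : ℂ)⁻¹ * (𝓕 F : 𝓢(ℂ, ℂ)) (((2 * Real.pi)⁻¹ * a : ℝ) : ℂ) := by
  have hpi : (Real.pi : ℂ) ≠ 0 := by exact_mod_cast Real.pi_ne_zero
  have h0 : 0 ≤ (2 * Real.pi)⁻¹ * a := by positivity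
  rw [SchwartzMap.fourier_coe, fourier_radial F hF, Complex.norm_real, Real.norm_of_nonneg h0,
    mul_inv_cancel_left₀ (by positivity)]
  field_simp

theorem integrableOn_hankel_inversion (F : 𝓢(ℂ, ℂ)) (hF : ∀ z, F z = F (‖z‖ : ℂ)) (y : ℝ) :
    IntegrableOn (fun a : ℝ => (a : ℂ) * ((besselJ0 (y * a) : ℂ) * hankel (fun ρ => F (ρ : ℂ)) a))
      (Ioi 0) := by
  have hpi : (Real.pi : ℂ) ≠ 0 := by exact_mod_cast Real.pi_ne_zero
  have h1 := ((integrable_id_mul_schwartz (𝓕 F)).comp_mul_left'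
    (R := (2 * Real.pi)⁻¹) (by positivity)).integrableOn (s := Ioi 0)
  have hJ : Continuous fun a : ℝ => (besselJ0 (y * a) : ℂ) :=
    Complex.continuous_ofReal.comp (continuous_besselJ0.comp (by fun_prop))
  have h2 := h1.bdd_mul (c := 1) hJ.aestronglyMeasurable (Filter.Eventually.of_forall fun s => by
    rw [Complex.norm_real]; exact abs_besselJ0_le_one _)
  refine IntegrableOn.congr_fun h2 (fun a ha => ?_) measurableSet_Ioi
  rw [hankel_eq_fourier F hF (le_of_lt ha)]
  push_cast
  field_simp

/-- Inversion of the Hankel transform of order zero. -/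
theorem hankel_inversion (F : 𝓢(ℂ, ℂ)) (hF : ∀ z, F z = F (‖z‖ : ℂ)) {y : ℝ} (hy : 0 ≤ y) :
    ∫ a in Ioi (0 : ℝ), (a : ℂ) * ((besselJ0 (y * a) : ℂ) * hankel (fun ρ => F (ρ : ℂ)) a) =
      F (y : ℂ) := by
  have hpi : (Real.pi : ℂ) ≠ 0 := by exact_mod_cast Real.pi_ne_zero
  have hpi' : (0 : ℝ) < 2 * Real.pi := by positivity
  have h1 : F (y : ℂ) = 𝓕 ((𝓕 F : 𝓢(ℂ, ℂ)) : ℂ → ℂ) (-(y : ℂ)) := by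
    rw [← Real.fourierInv_eq_fourier_neg, ← SchwartzMap.fourierInv_coe,
      FourierTransform.fourierInv_fourier_eq]
  rw [h1, fourier_radial _ (fourier_radial_radial F hF), norm_neg, Complex.norm_real,
    Real.norm_of_nonneg hy, hankel]
  have h2 := integral_comp_mul_left_Ioi
    (fun a : ℝ => (a : ℂ) * ((besselJ0 (y * a) : ℂ) * hankel (fun ρ => F (ρ : ℂ)) a)) 0 hpi'
  rw [mul_zero] at h2
  have h3 : ∀ ρ ∈ Ioi (0 : ℝ), (ρ : ℂ) * ((besselJ0 (2 * Real.pi * y * ρ) : ℂ) *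
      (𝓕 F : 𝓢(ℂ, ℂ)) (ρ : ℂ)) = ((2 * Real.pi * ρ : ℝ) : ℂ) *
      ((besselJ0 (y * (2 * Real.pi * ρ)) : ℂ) *
        hankel (fun ρ => F (ρ : ℂ)) (2 * Real.pi * ρ)) := by
    intro ρ hρ
    rw [hankel_eq_fourier F hF (mul_nonneg hpi'.le (le_of_lt hρ)), inv_mul_cancel_left₀ hpi'.ne',
      show y * (2 * Real.pi * ρ) = 2 * Real.pi * y * ρ by ring]
    push_cast
    field_simp
  rw [setIntegral_congr_fun measurableSet_Ioi h3, h2, Complex.real_smul]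
  push_cast
  field_simp

end SAR

/-! ### Radial lifts of Schwartz functions and square-root substitutions -/

namespace SAR

open scoped SchwartzMap Topology FourierTransform

section RadialLift

variable {V : Type*} [NormedAddCommGroup V] [InnerProductSpace ℝ V]

/-- Scaling by `c` exhibits the square root as a real power of `1 + ‖·‖²`, whose temperate growth is
known. The same form serves for the reciprocal. -/
theorem sqrt_norm_sq_add_sq {c : ℝ} (hc : 0 < c) (z : V) :
    √(‖z‖ ^ 2 + c ^ 2) = c * (1 + ‖c⁻¹ • z‖ ^ 2) ^ (1 / 2 : ℝ) := by
  rw [← Real.sqrt_eq_rpow, norm_smul, norm_inv, Real.norm_of_nonneg hc.le,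
    show ‖z‖ ^ 2 + c ^ 2 = c ^ 2 * (1 + (c⁻¹ * ‖z‖) ^ 2) by field_simp; ring,
    Real.sqrt_mul (by positivity), Real.sqrt_sq hc.le]

theorem hasTemperateGrowth_one_add_smul_rpow (c r : ℝ) :
    (fun z : V => (1 + ‖c • z‖ ^ 2) ^ r).HasTemperateGrowth :=
  (Function.hasTemperateGrowth_one_add_norm_sq_rpow V r).comp
    (c • ContinuousLinearMap.id ℝ V).hasTemperateGrowth

theorem hasTemperateGrowth_sqrt {c : ℝ} (hc : 0 < c) :
    (fun z : V => √(‖z‖ ^ 2 + c ^ 2)).HasTemperateGrowth := by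
  simp only [sqrt_norm_sq_add_sq hc]
  exact (Function.HasTemperateGrowth.const c).mul (hasTemperateGrowth_one_add_smul_rpow _ _)

theorem hasTemperateGrowth_inv_sqrt {c : ℝ} (hc : 0 < c) :
    (fun z : V => (√(‖z‖ ^ 2 + c ^ 2))⁻¹).HasTemperateGrowth := by
  have h : (fun z : V => (√(‖z‖ ^ 2 + c ^ 2))⁻¹) =
      fun z : V => c⁻¹ * (1 + ‖c⁻¹ • z‖ ^ 2) ^ (-(1 / 2) : ℝ) := by
    ext z
    rw [sqrt_norm_sq_add_sq hc, mul_inv, Real.rpow_neg (by positivity)]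
  rw [h]
  exact (Function.HasTemperateGrowth.const c⁻¹).mul (hasTemperateGrowth_one_add_smul_rpow _ _)

/-- Guarantees that composing with the square root preserves rapid decay. -/
theorem norm_le_sqrt_growth {V : Type*} [NormedAddCommGroup V] (c : ℝ) :
    ∃ (k : ℕ) (C : ℝ), ∀ z : V, ‖z‖ ≤ C * (1 + ‖√(‖z‖ ^ 2 + c ^ 2)‖) ^ k := by
  refine ⟨1, 1, fun z => ?_⟩
  rw [Real.norm_of_nonneg (Real.sqrt_nonneg _), pow_one, one_mul]
  have : ‖z‖ ≤ √(‖z‖ ^ 2 + c ^ 2) := Real.le_sqrt_of_sq_le (by nlinarith [sq_nonneg c])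
  linarith

/-- The Schwartz function `z ↦ Φ(√(‖z‖² + c²))`. -/
noncomputable def radialLift {c : ℝ} (hc : 0 < c) (Φ : 𝓢(ℝ, ℂ)) : 𝓢(V, ℂ) :=
  SchwartzMap.compCLM ℂ (hasTemperateGrowth_sqrt hc) (norm_le_sqrt_growth c) Φ

theorem radialLift_apply {c : ℝ} (hc : 0 < c) (Φ : 𝓢(ℝ, ℂ)) (z : V) :
    radialLift hc Φ z = Φ √(‖z‖ ^ 2 + c ^ 2) := rfl

/-- The Schwartz function `z ↦ Φ(√(‖z‖² + c²)) / √(‖z‖² + c²)`. -/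
noncomputable def radialLiftDiv {c : ℝ} (hc : 0 < c) (Φ : 𝓢(ℝ, ℂ)) : 𝓢(V, ℂ) :=
  SchwartzMap.smulLeftCLM ℂ (fun z : V => (√(‖z‖ ^ 2 + c ^ 2))⁻¹) (radialLift hc Φ)

theorem radialLiftDiv_apply {c : ℝ} (hc : 0 < c) (Φ : 𝓢(ℝ, ℂ)) (z : V) :
    radialLiftDiv hc Φ z = ((√(‖z‖ ^ 2 + c ^ 2))⁻¹ : ℝ) * Φ √(‖z‖ ^ 2 + c ^ 2) := by
  rw [radialLiftDiv, SchwartzMap.smulLeftCLM_apply_apply (hasTemperateGrowth_inv_sqrt hc),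
    radialLift_apply, Complex.real_smul]

end RadialLift

/-- The Schwartz function `s ↦ s Φ(√(s² + c²))`. -/
theorem exists_schwartz_mul_radialLift {c : ℝ} (hc : 0 < c) (Φ : 𝓢(ℝ, ℂ)) :
    ∃ q : 𝓢(ℝ, ℂ), ∀ s, q s = (s : ℂ) * Φ √(s ^ 2 + c ^ 2) := by
  refine ⟨SchwartzMap.smulLeftCLM ℂ (fun s : ℝ => s) (radialLift hc Φ), fun s => ?_⟩
  rw [SchwartzMap.smulLeftCLM_apply_apply Function.HasTemperateGrowth.id', radialLift_apply,
    Complex.real_smul, Real.norm_eq_abs, sq_abs]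

section Substitution

/-- The substitution `x = √(s² + c²)` on the half line. -/
theorem integral_Ioi_sqrt_sub {c : ℝ} (hc : 0 < c) (φ : ℝ → ℂ) :
    ∫ x in Ioi c, (x : ℂ) * φ x = ∫ s in Ioi (0 : ℝ), (s : ℂ) * φ √(s ^ 2 + c ^ 2) := by
  have himg : (fun s : ℝ => √(s ^ 2 + c ^ 2)) '' Ioi 0 = Ioi c := by
    ext x
    simp only [mem_image, mem_Ioi]
    constructor
    · rintro ⟨s, hs, rfl⟩
      exact Real.lt_sqrt_of_sq_lt (by nlinarith)
    · intro hx
      refine ⟨√(x ^ 2 - c ^ 2), Real.sqrt_pos.2 (by nlinarith), ?_⟩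
      rw [Real.sq_sqrt (by nlinarith), sub_add_cancel, Real.sqrt_sq (by linarith)]
  have hder : ∀ s ∈ Ioi (0 : ℝ), HasDerivWithinAt (fun s : ℝ => √(s ^ 2 + c ^ 2))
      (s / √(s ^ 2 + c ^ 2)) (Ioi 0) s := by
    intro s _
    have h := ((hasDerivAt_pow 2 s).add_const (c ^ 2)).sqrt (by positivity)
    refine (h.congr_deriv ?_).hasDerivWithinAt
    have : 0 < √(s ^ 2 + c ^ 2) := Real.sqrt_pos.2 (by positivity)
    field_simp
    push_cast
    ring
  have hinj : InjOn (fun s : ℝ => √(s ^ 2 + c ^ 2)) (Ioi 0) := by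
    intro s hs t ht h
    have h1 := congrArg (· ^ 2) h
    simp only at h1
    rw [Real.sq_sqrt (by positivity), Real.sq_sqrt (by positivity)] at h1
    exact (pow_left_inj₀ (le_of_lt hs) (le_of_lt ht) two_ne_zero).1 (by linarith)
  rw [← himg, integral_image_eq_integral_abs_deriv_smul measurableSet_Ioi hder hinj]
  refine setIntegral_congr_fun measurableSet_Ioi fun s hs => ?_
  have hpos : 0 < √(s ^ 2 + c ^ 2) := Real.sqrt_pos.2 (by positivity)
  have hs' : 0 < s := hs
  rw [abs_of_pos (by positivity), Complex.real_smul, ← mul_assoc]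
  congr 1
  rw [← Complex.ofReal_mul, div_mul_cancel₀ _ hpos.ne']

/-- The substitution `r = √(c² - t²)` on an interval. -/
theorem integral_Ioo_sqrt_sub {c : ℝ} (hc : 0 < c) (φ : ℝ → ℂ) :
    ∫ r in Ioo 0 c, (r : ℂ) * φ r = ∫ t in Ioo 0 c, (t : ℂ) * φ √(c ^ 2 - t ^ 2) := by
  have hmem : ∀ t ∈ Ioo 0 c, √(c ^ 2 - t ^ 2) ∈ Ioo 0 c := by
    rintro t ⟨h0, h1⟩
    refine ⟨Real.sqrt_pos.2 (by nlinarith), ?_⟩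
    rw [Real.sqrt_lt' hc]
    nlinarith
  have hinv : ∀ t ∈ Ioo 0 c, √(c ^ 2 - √(c ^ 2 - t ^ 2) ^ 2) = t := by
    rintro t ⟨h0, h1⟩
    rw [Real.sq_sqrt (by nlinarith), sub_sub_cancel, Real.sqrt_sq h0.le]
  have himg : (fun t : ℝ => √(c ^ 2 - t ^ 2)) '' Ioo 0 c = Ioo 0 c := by
    ext x
    exact ⟨by rintro ⟨t, ht, rfl⟩; exact hmem t ht, fun hx => ⟨_, hmem x hx, hinv x hx⟩⟩
  have hder : ∀ s ∈ Ioo 0 c, HasDerivWithinAt (fun s : ℝ => √(c ^ 2 - s ^ 2))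
      (-(s / √(c ^ 2 - s ^ 2))) (Ioo 0 c) s := by
    rintro s ⟨h0, h1⟩
    have hp : 0 < c ^ 2 - s ^ 2 := by nlinarith
    have h := ((hasDerivAt_pow 2 s).const_sub (c ^ 2)).sqrt hp.ne'
    refine (h.congr_deriv ?_).hasDerivWithinAt
    have : 0 < √(c ^ 2 - s ^ 2) := Real.sqrt_pos.2 hp
    field_simp
    push_cast
    ring
  have hinj : InjOn (fun s : ℝ => √(c ^ 2 - s ^ 2)) (Ioo 0 c) := by
    intro s hs t ht h
    have h' : √(c ^ 2 - s ^ 2) = √(c ^ 2 - t ^ 2) := h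
    rw [← hinv s hs, ← hinv t ht, h']
  conv_lhs => rw [← himg]
  rw [integral_image_eq_integral_abs_deriv_smul measurableSet_Ioo hder hinj]
  refine setIntegral_congr_fun measurableSet_Ioo fun s hs => ?_
  have hpos : 0 < √(c ^ 2 - s ^ 2) := (hmem s hs).1
  have hs' : 0 < s := hs.1
  rw [abs_neg, abs_of_pos (by positivity), Complex.real_smul, ← mul_assoc]
  congr 1
  rw [← Complex.ofReal_mul, div_mul_cancel₀ _ hpos.ne']

end Substitution

end SAR

/-! ### Fourier cosine series of functions with bounded derivative -/

namespace SAR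

open scoped SchwartzMap Topology FourierTransform

/-- Integration by parts, without boundary term since the endpoint values agree, bounds the `n`-th
coefficient of `K` by a multiple of `1/|n|` times that of the bounded function `K'`. The latter
coefficients are square summable, and so is `1/n`. Right derivatives suffice, which admits a corner
of an even extension at `0`. -/
theorem summable_fourierCoeffOn_of_bounded_deriv {a b : ℝ} (hab : a < b) {K : ℝ → ℂ} {C : ℝ}
    (hK : ContinuousOn K (Icc a b)) (hKab : K a = K b)
    (hd : ∀ t ∈ Ioo a b, ∃ h', ‖h'‖ ≤ C ∧ HasDerivWithinAt K h' (Ioi t) t) :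
    Summable (fourierCoeffOn hab K) := by
  set K' : ℝ → ℂ := fun t => derivWithin K (Ioi t) t with hK'
  have hd' : ∀ t ∈ Ioo a b, ‖K' t‖ ≤ C ∧ HasDerivWithinAt K (K' t) (Ioi t) t := by
    intro t ht
    obtain ⟨h', hC, hh⟩ := hd t ht
    have : K' t = h' := hh.derivWithin (uniqueDiffWithinAt_Ioi t)
    rw [this]
    exact ⟨hC, hh⟩
  have hKm : Measurable K' := measurable_derivWithin_Ioi K
  have hbound : ∀ᵐ t ∂(volume.restrict (Ioc a b)), ‖K' t‖ ≤ C := by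
    rw [← restrict_Ioo_eq_restrict_Ioc]
    exact (ae_restrict_iff' measurableSet_Ioo).2 (Filter.Eventually.of_forall fun t ht =>
      (hd' t ht).1)
  have hL2 : MemLp K' 2 (volume.restrict (Ioc a b)) :=
    MemLp.of_bound hKm.aestronglyMeasurable C hbound
  have hint : IntervalIntegrable K' volume a b := by
    rw [intervalIntegrable_iff_integrableOn_Ioc_of_le hab.le]
    exact Integrable.of_bound hKm.aestronglyMeasurable C hbound
  have hs1 := (hasSum_sq_fourierCoeffOn hab hL2).summable
  have hs2 : Summable fun n : ℤ => 1 / (n : ℝ) ^ 2 :=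
    Real.summable_one_div_int_pow.2 one_lt_two
  refine Summable.of_norm_bounded_eventually (((hs1.add hs2).mul_left (b - a))) ?_
  filter_upwards [(Set.finite_singleton (0 : ℤ)).compl_mem_cofinite] with n hn
  have hn : n ≠ 0 := hn
  have hn' : (0 : ℝ) < |(n : ℝ)| := abs_pos.2 (by exact_mod_cast hn)
  have hmin : min a b = a := min_eq_left hab.le
  have hmax : max a b = b := max_eq_right hab.le
  rw [fourierCoeffOn_of_hasDeriv_right hab hn (by rwa [uIcc_of_le hab.le])
    (by rw [hmin, hmax]; exact fun t ht => (hd' t ht).2) hint, hKab, sub_self, mul_zero, zero_sub,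
    norm_mul, norm_neg, norm_mul, norm_div, norm_one]
  have e1 : ‖(-2 * Real.pi * Complex.I * n : ℂ)‖ = 2 * Real.pi * |(n : ℝ)| := by
    simp [abs_of_pos Real.pi_pos]
  have e2 : ‖((b : ℂ) - a)‖ = b - a := by
    rw [← Complex.ofReal_sub, Complex.norm_real, Real.norm_of_nonneg (by linarith)]
  rw [e1, e2]
  set d := ‖fourierCoeffOn hab K' n‖
  have hdn : 0 ≤ d := norm_nonneg _
  have h1 : 1 / (2 * Real.pi * |(n : ℝ)|) ≤ 1 / |(n : ℝ)| := by
    apply one_div_le_one_div_of_le hn'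
    nlinarith [Real.pi_gt_three]
  have h2 : 1 / |(n : ℝ)| * d ≤ d ^ 2 + 1 / (n : ℝ) ^ 2 := by
    have : 1 / (n : ℝ) ^ 2 = (1 / |(n : ℝ)|) ^ 2 := by rw [div_pow, one_pow, sq_abs]
    rw [this]
    nlinarith [sq_nonneg (d - 1 / |(n : ℝ)|), sq_nonneg (d + 1 / |(n : ℝ)|)]
  calc 1 / (2 * Real.pi * |(n : ℝ)|) * ((b - a) * d)
      ≤ 1 / |(n : ℝ)| * ((b - a) * d) := by
        gcongr
    _ = (b - a) * (1 / |(n : ℝ)| * d) := by ring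
    _ ≤ _ := by
        gcongr

theorem fourierCoeffOn_comp_abs {R : ℝ} (hR : -R < R) {H : ℝ → ℂ} (hc : ContinuousOn H (Icc 0 R))
    (n : ℤ) :
    fourierCoeffOn hR (fun t => H |t|) n =
      (1 / R : ℝ) * ∫ s in Ioo 0 R, (Real.cos (n * (Real.pi / R) * s) : ℂ) * H s := by
  have hR0 : 0 < R := by linarith
  have hRc : (R : ℂ) ≠ 0 := by exact_mod_cast hR0.ne'
  set E : ℝ → ℂ := fun s => Complex.exp (((-(n * (Real.pi / R) * s) : ℝ) : ℂ) * Complex.I) with hE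
  have hEc : Continuous E := by fun_prop
  have hf : ∀ s : ℝ, fourier (-n) (s : AddCircle (R - -R)) • H |s| = E s * H |s| := by
    intro s
    rw [fourier_coe_apply, smul_eq_mul]
    congr 2
    push_cast
    field_simp
    ring
  have habs : ContinuousOn (fun s : ℝ => H |s|) (Icc (-R) R) :=
    hc.comp continuous_abs.continuousOn fun s hs => ⟨abs_nonneg _, abs_le.2 hs⟩
  have hi1 : IntervalIntegrable (fun s => E s * H |s|) volume (-R) 0 := by
    refine ContinuousOn.intervalIntegrable (hEc.continuousOn.mul (habs.mono ?_))
    rw [uIcc_of_le (by linarith)]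
    exact Icc_subset_Icc_right hR0.le
  have hi2 : IntervalIntegrable (fun s => E s * H |s|) volume 0 R := by
    refine ContinuousOn.intervalIntegrable (hEc.continuousOn.mul (habs.mono ?_))
    rw [uIcc_of_le hR0.le]
    exact Icc_subset_Icc_left (by linarith)
  rw [fourierCoeffOn_eq_integral]
  simp only [hf]
  rw [← intervalIntegral.integral_add_adjacent_intervals hi1 hi2]
  have h2 : ∫ s in (-R)..0, E s * H |s| = ∫ s in (0 : ℝ)..R, E (-s) * H |s| := by
    have := intervalIntegral.integral_comp_neg (a := 0) (b := R) (fun s => E s * H |s|)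
    simp only [abs_neg, neg_zero] at this
    exact this.symm
  have hi3 : IntervalIntegrable (fun s => E (-s) * H |s|) volume 0 R := by
    refine ContinuousOn.intervalIntegrable
      ((hEc.comp continuous_neg).continuousOn.mul (habs.mono ?_))
    rw [uIcc_of_le hR0.le]
    exact Icc_subset_Icc_left (by linarith)
  rw [h2, ← intervalIntegral.integral_add hi3 hi2, intervalIntegral.integral_of_le hR0.le,
    integral_Ioc_eq_integral_Ioo]
  have h3 : ∀ s ∈ Ioo 0 R, E (-s) * H |s| + E s * H |s| =
      2 * ((Real.cos (n * (Real.pi / R) * s) : ℂ) * H s) := by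
    intro s hs
    rw [abs_of_pos hs.1, Complex.ofReal_cos, Complex.cos]
    simp only [hE]
    push_cast
    ring_nf
  rw [setIntegral_congr_fun measurableSet_Ioo h3, integral_const_mul, Complex.real_smul]
  push_cast
  field_simp
  ring

/-- Convergence of the cosine series of a function with bounded derivative. -/
theorem hasSum_cosine_series {R C : ℝ} (hR : 0 < R) {H : ℝ → ℂ} (hc : ContinuousOn H (Icc 0 R))
    (hd : ∀ t ∈ Ico 0 R, ∃ h', ‖h'‖ ≤ C ∧ HasDerivAt H h' t) {t : ℝ} (ht : t ∈ Ico 0 R) :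
    HasSum (fun n : ℕ => ((neumannNumber n / R * Real.cos (n * (Real.pi / R) * t) : ℝ) : ℂ) *
      ∫ s in Ioo 0 R, (Real.cos (n * (Real.pi / R) * s) : ℂ) * H s) (H t) := by
  have hRR : -R < R := by linarith
  have hRc : (R : ℂ) ≠ 0 := by exact_mod_cast hR.ne'
  -- The even extension takes equal values at `-R` and `R`, so its periodization is continuous.
  set K : ℝ → ℂ := fun t => H |t| with hK
  have hKc : ContinuousOn K (Icc (-R) R) :=
    hc.comp continuous_abs.continuousOn fun s hs => ⟨abs_nonneg _, abs_le.2 hs⟩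
  have hKd : ∀ t ∈ Ioo (-R) R, ∃ h', ‖h'‖ ≤ C ∧ HasDerivWithinAt K h' (Ioi t) t := by
    intro t ht
    rcases le_or_gt 0 t with h0 | h0
    · obtain ⟨h', hC, hh⟩ := hd t ⟨h0, ht.2⟩
      refine ⟨h', hC, hh.hasDerivWithinAt.congr (fun s hs => ?_) ?_⟩
      · simp only [hK, abs_of_nonneg (h0.trans (le_of_lt hs))]
      · simp only [hK, abs_of_nonneg h0]
    · obtain ⟨h', hC, hh⟩ := hd (-t) ⟨by linarith, by linarith [ht.1]⟩
      refine ⟨-h', by rwa [norm_neg], HasDerivAt.hasDerivWithinAt ?_⟩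
      have h1 : HasDerivAt (fun s => H (-s)) (-h') t := by
        have := HasDerivAt.scomp t hh (hasDerivAt_neg t)
        simpa [Function.comp_def] using this
      refine h1.congr_of_eventuallyEq ?_
      filter_upwards [Iio_mem_nhds h0] with s hs
      simp only [hK, abs_of_neg (mem_Iio.1 hs)]
  have hsum := summable_fourierCoeffOn_of_bounded_deriv hRR hKc (by simp [hK]) hKd
  set c : ℤ → ℂ := fun n =>
    (1 / R : ℝ) * ∫ s in Ioo 0 R, (Real.cos (n * (Real.pi / R) * s) : ℂ) * H s with hcdef
  have hcoef : fourierCoeffOn hRR K = c := funext fun n => fourierCoeffOn_comp_abs hRR hc n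
  have : Fact (0 < 2 * R) := ⟨by positivity⟩
  have hend : -R + 2 * R = R := by ring
  have hcont : Continuous (AddCircle.liftIco (2 * R) (-R) K) := by
    refine AddCircle.liftIco_continuous ?_ ?_
    · simp [hK, hend]
    · rwa [hend]
  have hcoef' : fourierCoeff (AddCircle.liftIco (2 * R) (-R) K) = c := by
    rw [← hcoef]
    ext n
    rw [fourierCoeff_liftIco_eq]
    simp only [hend]
  have hser := has_pointwise_sum_fourier_series_of_summable
    (f := ⟨AddCircle.liftIco (2 * R) (-R) K, hcont⟩) (by
      simp only [ContinuousMap.coe_mk, hcoef']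
      rwa [← hcoef]) (t : AddCircle (2 * R))
  simp only [ContinuousMap.coe_mk, hcoef'] at hser
  rw [AddCircle.liftIco_coe_apply ⟨by linarith [ht.1], by linarith [ht.2]⟩] at hser
  have hKt : K t = H t := by simp only [hK, abs_of_nonneg ht.1]
  rw [hKt] at hser
  have hcneg : ∀ n : ℤ, c (-n) = c n := by
    intro n
    simp only [hcdef]
    push_cast
    simp only [neg_mul, Complex.cos_neg]
  have h1 := hser.nat_add_neg
  -- Folding the sum over the integers onto `n` and `-n` counts the term `n = 0` twice. Removing one
  -- copy is what makes the Neumann number `1` at `n = 0` and `2` elsewhere.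
  have h2 := h1.sub (hasSum_ite_eq (0 : ℕ) (c 0 • fourier 0 (t : AddCircle (2 * R))))
  rw [add_sub_cancel_right] at h2
  refine h2.congr_fun fun n => ?_
  have h3 : c n • fourier n (t : AddCircle (2 * R)) + c (-n) • fourier (-n) (t : AddCircle (2 * R)) =
      2 * c n * Real.cos (n * (Real.pi / R) * t) := by
    rw [hcneg, ← smul_add, smul_eq_mul, fourier_coe_apply, fourier_coe_apply, Complex.ofReal_cos,
      Complex.cos]
    have e1 : (2 * Real.pi * Complex.I * ((n : ℤ) : ℂ) * t / ((2 * R : ℝ) : ℂ) : ℂ) =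
        ((n * (Real.pi / R) * t : ℝ) : ℂ) * Complex.I := by
      push_cast
      field_simp
    have e2 : (2 * Real.pi * Complex.I * ((-(n : ℤ) : ℤ) : ℂ) * t / ((2 * R : ℝ) : ℂ) : ℂ) =
        -((n * (Real.pi / R) * t : ℝ) : ℂ) * Complex.I := by
      push_cast
      field_simp
    rw [e1, e2]
    ring
  rw [h3, neumannNumber]
  split_ifs with h
  · subst h
    simp [hcdef]
    ring
  · simp [hcdef]
    ring

end SAR

/-! ### Regularity, decay and parity of the spherical Radon transform -/

namespace SAR

open scoped SchwartzMap Topology FourierTransform Pointwise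

instance : IsFiniteMeasure circleMeasure := by
  unfold circleMeasure
  infer_instance

/-- The measure of a set on the circle is a constant times the area of the cone over it, and
Lebesgue measure is invariant under negation. -/
theorem map_neg_circleMeasure : circleMeasure.map (fun ω => -ω) = circleMeasure := by
  ext s hs
  have hm : Measurable fun ω : Metric.sphere (0 : EuclideanSpace ℝ (Fin 2)) 1 => -ω :=
    continuous_neg.measurable
  rw [Measure.map_apply hm hs, circleMeasure, Measure.toSphere_apply' _ (hm hs),
    Measure.toSphere_apply' _ hs]
  congr 1
  rw [← Measure.measure_neg]
  congr 1
  ext x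
  simp only [Set.mem_neg, Set.mem_smul, mem_image, mem_preimage]
  constructor
  · rintro ⟨ρ, hρ, _, ⟨ω, hω, rfl⟩, h⟩
    refine ⟨ρ, hρ, _, ⟨-ω, hω, rfl⟩, ?_⟩
    rw [coe_neg_sphere, smul_neg, h, neg_neg]
  · rintro ⟨ρ, hρ, _, ⟨ω, hω, rfl⟩, h⟩
    refine ⟨ρ, hρ, _, ⟨-ω, by simpa using hω, rfl⟩, ?_⟩
    rw [coe_neg_sphere, smul_neg, h]

theorem integral_comp_neg_circleMeasure
    (φ : Metric.sphere (0 : EuclideanSpace ℝ (Fin 2)) 1 → ℂ) :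
    ∫ ω, φ (-ω) ∂circleMeasure = ∫ ω, φ ω ∂circleMeasure := by
  conv_rhs => rw [← map_neg_circleMeasure]
  exact (integral_map_equiv (Homeomorph.neg _).toMeasurableEquiv φ).symm

/-- The unit vector in the direction of the first coordinate axis. -/
noncomputable def axis : EuclideanSpace ℝ (Fin 2) := EuclideanSpace.single 0 1

theorem norm_axis : ‖axis‖ = 1 := by simp [axis]

section Radon

variable (f : SchwartzMap (EuclideanSpace ℝ (Fin 2)) ℂ)

theorem sphericalRadon_eq (x r : ℝ) :
    sphericalRadon f x r = ((circleMeasure.real univ)⁻¹ : ℝ) •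
      ∫ ω : Metric.sphere (0 : EuclideanSpace ℝ (Fin 2)) 1, 
        f (x • axis + r • (ω : EuclideanSpace ℝ (Fin 2)))
        ∂circleMeasure := by
  rw [sphericalRadon]
  congr 2
  ext ω
  congr 1
  ext i
  fin_cases i <;> simp [axis]

theorem sphericalRadon_neg (x r : ℝ) : sphericalRadon f x (-r) = sphericalRadon f x r := by
  rw [sphericalRadon_eq, sphericalRadon_eq, ← integral_comp_neg_circleMeasure]
  simp

theorem continuous_sphericalRadon : Continuous fun p : ℝ × ℝ => sphericalRadon f p.1 p.2 := by
  simp only [sphericalRadon_eq]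
  have h : Continuous fun p : ℝ × ℝ =>
      ∫ ω : Metric.sphere (0 : EuclideanSpace ℝ (Fin 2)) 1,
        f (p.1 • axis + p.2 • (ω : EuclideanSpace ℝ (Fin 2))) ∂circleMeasure := by
    refine continuous_of_dominated (bound := fun _ => SchwartzMap.seminorm ℝ 0 0 f)
      (fun p => ?_) (fun p => ?_) (integrable_const _) ?_
    · exact Continuous.aestronglyMeasurable (by fun_prop)
    · exact Filter.Eventually.of_forall fun ω => SchwartzMap.norm_le_seminorm ℝ f _
    · exact Filter.Eventually.of_forall fun ω => by fun_prop
  exact h.const_smul ((circleMeasure.real univ)⁻¹ : ℝ)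

/-- The spherical Radon transform is a Schwartz function of the radius. -/
theorem exists_schwartz_sphericalRadon (x : ℝ) :
    ∃ Φ : 𝓢(ℝ, ℂ), ∀ r, Φ r = sphericalRadon f x r := by
  obtain ⟨Φ, hΦ⟩ := exists_schwartz_integral circleMeasure
    (fun ω => lineRestrict f (x • axis) (ω : EuclideanSpace ℝ (Fin 2)) (by simp))
    (fun u => Continuous.aestronglyMeasurable (by simp only [lineRestrict_apply]; fun_prop))
    (fun k n => by
      obtain ⟨C, hC⟩ := seminorm_lineRestrict_bound f ‖x • axis‖ k n
      exact ⟨C, fun ω => hC _ _ _ le_rfl⟩)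
  refine ⟨(circleMeasure.real univ)⁻¹ • Φ, fun r => ?_⟩
  rw [sphericalRadon_eq, smul_apply, hΦ]
  rfl

/-- For radii below `R` the point `r ω` stays in a fixed ball, so the decay of `f` along horizontal
lines is uniform. Powers `1` and `3` enter because `|x| (1 + x²) = |x| + |x|³`. -/
theorem sphericalRadon_decay (R : ℝ) : ∃ C, ∀ x : ℝ, ∀ r ∈ Ioo 0 R,
    ‖(x : ℂ) * sphericalRadon f x r‖ ≤ C * (1 + x ^ 2)⁻¹ := by
  obtain ⟨C₁, hC₁⟩ := iteratedFDeriv_lineRestrict_bound f R 1 0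
  obtain ⟨C₃, hC₃⟩ := iteratedFDeriv_lineRestrict_bound f R 3 0
  refine ⟨(circleMeasure.real univ)⁻¹ * ((C₁ + C₃) * circleMeasure.real univ), fun x r hr => ?_⟩
  rw [← div_eq_mul_inv, le_div_iff₀ (by positivity), sphericalRadon_eq, norm_mul, norm_smul,
    norm_inv, Real.norm_of_nonneg measureReal_nonneg, Complex.norm_real]
  have h : ∀ ω : Metric.sphere (0 : EuclideanSpace ℝ (Fin 2)) 1,
      ‖((‖x‖ * (1 + x ^ 2) : ℝ) : ℂ) * f (x • axis + r • (ω : EuclideanSpace ℝ (Fin 2)))‖ ≤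
        C₁ + C₃ := by
    intro ω
    have hp : ‖r • (ω : EuclideanSpace ℝ (Fin 2))‖ ≤ R := by
      rw [norm_smul, norm_eq_of_mem_sphere, mul_one, Real.norm_of_nonneg hr.1.le]
      exact hr.2.le
    have h1 := hC₁ _ axis hp norm_axis x
    have h3 := hC₃ _ axis hp norm_axis x
    rw [norm_iteratedFDeriv_zero, add_comm (r • _)] at h1 h3
    rw [norm_mul, Complex.norm_real, Real.norm_of_nonneg (by positivity)]
    have e : x ^ 2 = ‖x‖ ^ 2 := by rw [Real.norm_eq_abs, sq_abs]
    rw [e]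
    linarith
  have h' := norm_integral_le_of_norm_le_const (μ := circleMeasure) (Filter.Eventually.of_forall h)
  rw [integral_const_mul, norm_mul, Complex.norm_real, Real.norm_of_nonneg (by positivity)] at h'
  calc _ = (circleMeasure.real univ)⁻¹ * (‖x‖ * (1 + x ^ 2) *
        ‖∫ ω : Metric.sphere (0 : EuclideanSpace ℝ (Fin 2)) 1,
          f (x • axis + r • (ω : EuclideanSpace ℝ (Fin 2))) ∂circleMeasure‖) := by ring
    _ ≤ _ := by gcongr

/-- Averages of the spherical Radon transform over the radius are Schwartz functions of the
centre. -/
theorem exists_schwartz_integral_sphericalRadon {R M : ℝ} {w : ℝ → ℝ} (hw : Continuous w)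
    (hM : ∀ r ∈ Ioo 0 R, |w r| ≤ M) :
    ∃ Φ : 𝓢(ℝ, ℂ), ∀ x, Φ x = ∫ r in Ioo 0 R, (w r : ℂ) * sphericalRadon f x r := by
  classical
  -- The value `0` outside `(0,R)` makes the seminorm bounds hold at every parameter; the product
  -- measure does not see those radii.
  set F : ℝ × Metric.sphere (0 : EuclideanSpace ℝ (Fin 2)) 1 → 𝓢(ℝ, ℂ) := fun p =>
    if p.1 ∈ Ioo 0 R then
      (w p.1 : ℝ) • lineRestrict f ((p.1 : ℝ) • (p.2 : EuclideanSpace ℝ (Fin 2))) axis norm_axis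
    else 0 with hF
  have hFin : ∀ (p : ℝ × Metric.sphere (0 : EuclideanSpace ℝ (Fin 2)) 1) (u : ℝ), p.1 ∈ Ioo 0 R →
      F p u = (w p.1 : ℂ) * f (u • axis + p.1 • (p.2 : EuclideanSpace ℝ (Fin 2))) := by
    intro p u hp
    simp only [hF, if_pos hp]
    rw [smul_apply, lineRestrict_apply, Complex.real_smul, add_comm]
  have hFc : ∀ u : ℝ, Continuous fun p : ℝ × Metric.sphere (0 : EuclideanSpace ℝ (Fin 2)) 1 =>
      (w p.1 : ℂ) * f (u • axis + p.1 • (p.2 : EuclideanSpace ℝ (Fin 2))) := by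
    intro u
    fun_prop
  have hFm : ∀ u, AEStronglyMeasurable (fun p => F p u)
      ((volume.restrict (Ioo 0 R)).prod circleMeasure) := by
    intro u
    refine (hFc u).aestronglyMeasurable.congr ?_
    have h1 : ∀ᵐ p ∂((volume.restrict (Ioo 0 R)).prod circleMeasure), p.1 ∈ Ioo 0 R :=
      Measure.quasiMeasurePreserving_fst.ae (ae_restrict_mem measurableSet_Ioo)
    filter_upwards [h1] with p hp
    rw [hFin p u hp]
  have hFb : ∀ k n, ∃ C, ∀ p, SchwartzMap.seminorm ℝ k n (F p) ≤ C := by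
    intro k n
    obtain ⟨C, hC⟩ := seminorm_lineRestrict_bound f R k n
    refine ⟨max (M * C) 0, fun p => ?_⟩
    by_cases hp : p.1 ∈ Ioo 0 R
    · simp only [hF, if_pos hp]
      have hpn : ‖p.1 • (p.2 : EuclideanSpace ℝ (Fin 2))‖ ≤ R := by
        rw [norm_smul, norm_eq_of_mem_sphere, mul_one, Real.norm_of_nonneg hp.1.le]
        exact hp.2.le
      rw [map_smul_eq_mul]
      refine le_trans ?_ (le_max_left _ _)
      exact mul_le_mul (hM _ hp) (hC _ _ _ hpn) (apply_nonneg _ _)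
        ((abs_nonneg _).trans (hM _ hp))
    · simp only [hF, if_neg hp, map_zero]
      exact le_max_right _ _
  obtain ⟨Φ, hΦ⟩ := exists_schwartz_integral _ F hFm hFb
  refine ⟨(circleMeasure.real univ)⁻¹ • Φ, fun x => ?_⟩
  have hint : Integrable (fun p => F p x) ((volume.restrict (Ioo 0 R)).prod circleMeasure) := by
    obtain ⟨C, hC⟩ := hFb 0 0
    exact Integrable.of_bound (hFm x) C
      (Filter.Eventually.of_forall fun p => (norm_le_seminorm_zero _ _).trans (hC p))
  rw [smul_apply, hΦ, integral_prod _ hint, ← integral_smul]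
  refine setIntegral_congr_fun measurableSet_Ioo fun r hr => ?_
  simp only [hFin (r, _) x hr]
  rw [integral_const_mul, sphericalRadon_eq, mul_smul_comm]

end Radon

/-- The functions to which the cosine series is applied have bounded derivative. -/
theorem exists_bounded_deriv_mul_comp_sqrt {R : ℝ} (ψ : 𝓢(ℝ, ℂ)) (he : ∀ r, ψ (-r) = ψ r) :
    ∃ C, ∀ t ∈ Ico 0 R, ∃ h', ‖h'‖ ≤ C ∧
      HasDerivAt (fun t : ℝ => (t : ℂ) * ψ √(R ^ 2 - t ^ 2)) h' t := by
  set ψ₁ := SchwartzMap.derivCLM ℝ ℂ ψ with hψ₁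
  set ψ₂ := SchwartzMap.derivCLM ℝ ℂ ψ₁ with hψ₂
  have hd0 : ∀ s, HasDerivAt ψ (ψ₁ s) s := fun s => by
    simpa [hψ₁] using (ψ.differentiable (x := s)).hasDerivAt
  have hd1 : ∀ s, HasDerivAt ψ₁ (ψ₂ s) s := fun s => by
    simpa [hψ₂] using (ψ₁.differentiable (x := s)).hasDerivAt
  -- The derivative of an even function is odd. With the mean value inequality this gives `‖ψ'(s)‖ ≤
  -- B |s|`, which cancels the factor `1/√(R² - t²)` produced by the chain rule.
  have h0 : ψ₁ 0 = 0 := by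
    have h1 : HasDerivAt (fun s => ψ (-s)) (-ψ₁ 0) 0 := by
      have := HasDerivAt.scomp (0 : ℝ) (by simpa using hd0 0) (hasDerivAt_neg (0 : ℝ))
      simpa [Function.comp_def] using this
    simp only [he] at h1
    have := h1.unique (hd0 0)
    exact self_eq_neg.1 this.symm
  set A := SchwartzMap.seminorm ℝ 0 0 ψ
  set B := SchwartzMap.seminorm ℝ 0 0 ψ₂
  have hlip : ∀ s, ‖ψ₁ s‖ ≤ B * |s| := by
    intro s
    have := (convex_univ (𝕜 := ℝ) (E := ℝ)).norm_image_sub_le_of_norm_hasDerivWithin_le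
      (f := ψ₁) (f' := ψ₂) (C := B) (fun s _ => (hd1 s).hasDerivWithinAt)
      (fun s _ => norm_le_seminorm_zero _ _) (mem_univ 0) (mem_univ s)
    simpa [h0] using this
  refine ⟨A + R * (B * R), fun t ht => ?_⟩
  have hR : 0 < R := ht.1.trans_lt ht.2
  have hp : 0 < R ^ 2 - t ^ 2 := by nlinarith [ht.1, ht.2]
  have hs : 0 < √(R ^ 2 - t ^ 2) := Real.sqrt_pos.2 hp
  have hsq : HasDerivAt (fun t : ℝ => √(R ^ 2 - t ^ 2)) (-(t / √(R ^ 2 - t ^ 2))) t := by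
    refine (((hasDerivAt_pow 2 t).const_sub (R ^ 2)).sqrt hp.ne').congr_deriv ?_
    field_simp
    push_cast
    ring
  have hcomp := HasDerivAt.scomp t (hd0 _) hsq
  have h := (HasDerivAt.ofReal_comp (hasDerivAt_id t)).mul hcomp
  refine ⟨_, ?_, h⟩
  refine (norm_add_le _ _).trans ?_
  have hB : 0 ≤ B := apply_nonneg _ _
  gcongr
  · simpa using norm_le_seminorm_zero ψ _
  · rw [norm_mul, norm_smul, norm_neg, norm_div, Complex.norm_real, Real.norm_of_nonneg hs.le]
    simp only [id, Real.norm_of_nonneg ht.1]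
    have h1 := hlip √(R ^ 2 - t ^ 2)
    rw [abs_of_pos hs] at h1
    have h2 : t / √(R ^ 2 - t ^ 2) * ‖ψ₁ √(R ^ 2 - t ^ 2)‖ ≤ B * t := by
      rw [div_mul_eq_mul_div, div_le_iff₀ hs]
      nlinarith [ht.1]
    have h3 : B * t ≤ B * R := mul_le_mul_of_nonneg_left ht.2.le hB
    exact mul_le_mul ht.2.le (h2.trans h3)
      (mul_nonneg (div_nonneg ht.1 hs.le) (norm_nonneg _)) hR.le

end SAR

/-! ### Range reconstruction, and reduction of the projections to Hankel transforms and cosine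
series -/

namespace SAR

open scoped SchwartzMap Topology FourierTransform

section Range

variable (f : SchwartzMap (EuclideanSpace ℝ (Fin 2)) ℂ) {R : ℝ}

/-- The point mass evaluates `v` at `a`, and the weight `√(r² - R²)` cancels the denominator of the
kernel. The remaining factor `r` is the Jacobian factor of the substitution. -/
theorem oRangeInnerIntegrand_eq {b r : ℝ} (hR : 0 < R) (hr : R < r) (a : ℝ) (v : ℝ → ℝ → ℂ) :
    oRangeInnerIntegrand R a b v r = (r : ℂ) * ((Real.cos (b * √(r ^ 2 - R ^ 2)) : ℂ) * v a r) := by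
  have hs : 0 < √(r ^ 2 - R ^ 2) := Real.sqrt_pos.2 (by nlinarith)
  have hs' : ((√(r ^ 2 - R ^ 2) : ℝ) : ℂ) ≠ 0 := by exact_mod_cast hs.ne'
  rw [oRangeInnerIntegrand, integral_dirac, oRangeRadial, if_pos hr]
  push_cast
  field_simp

theorem integrableOn_oRangeInnerIntegrand (hR : 0 < R) (a b : ℝ) :
    IntegrableOn (oRangeInnerIntegrand R a b (sphericalRadon f)) (Ioi R) := by
  obtain ⟨Φ, hΦ⟩ := exists_schwartz_sphericalRadon f a
  have h1 : Integrable fun r : ℝ => (r : ℂ) * Φ r := by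
    refine (Φ.integrable_pow_mul volume 1).mono' (Continuous.aestronglyMeasurable (by fun_prop)) ?_
    exact Filter.Eventually.of_forall fun r => by simp
  have hc : Continuous fun r : ℝ => (Real.cos (b * √(r ^ 2 - R ^ 2)) : ℂ) := by fun_prop
  have h2 := (h1.integrableOn (s := Ioi R)).bdd_mul (c := 1) hc.aestronglyMeasurable
    (Filter.Eventually.of_forall fun r => by
      rw [Complex.norm_real]; exact Real.abs_cos_le_one _)
  refine IntegrableOn.congr_fun h2 (fun r hr => ?_) measurableSet_Ioi
  rw [oRangeInnerIntegrand_eq hR hr, ← hΦ]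
  ring

theorem exists_GRange_eq_cosTransform (hR : 0 < R) (a : ℝ) :
    ∃ q : 𝓢(ℝ, ℂ), (∀ s, q s = (s : ℂ) * sphericalRadon f a √(s ^ 2 + R ^ 2)) ∧
      ∀ b, GRange R (sphericalRadon f) a b = (2 / Real.pi : ℝ) * cosTransform q b := by
  obtain ⟨Φ, hΦ⟩ := exists_schwartz_sphericalRadon f a
  obtain ⟨q, hq⟩ := exists_schwartz_mul_radialLift hR Φ
  refine ⟨q, fun s => by rw [hq, hΦ], fun b => ?_⟩
  rw [GRange, oRangeInner, setIntegral_congr_fun measurableSet_Ioi fun r hr =>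
    oRangeInnerIntegrand_eq hR hr a _, integral_Ioi_sqrt_sub hR, cosTransform]
  congr 1
  refine setIntegral_congr_fun measurableSet_Ioi fun s hs => ?_
  rw [hq, hΦ, Real.sq_sqrt (by positivity), add_sub_cancel_right, Real.sqrt_sq (le_of_lt hs)]
  ring

theorem oRange_reconstruction (hR : 0 < R) {x r : ℝ} (hr : R < r) :
    IntegrableOn (oRangeSuperposition R (GRange R (sphericalRadon f)) x r) (Ioi 0) ∧
      sphericalRadon f x r =
        ∫ b in Ioi (0 : ℝ), oRangeSuperposition R (GRange R (sphericalRadon f)) x r b := by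
  obtain ⟨q, hq, hG⟩ := exists_GRange_eq_cosTransform f hR x
  have hs : 0 < √(r ^ 2 - R ^ 2) := Real.sqrt_pos.2 (by nlinarith)
  set s := √(r ^ 2 - R ^ 2) with hsdef
  have hs' : (s : ℂ) ≠ 0 := by exact_mod_cast hs.ne'
  have hsup : oRangeSuperposition R (GRange R (sphericalRadon f)) x r = fun b =>
      ((2 / Real.pi : ℝ) / s : ℂ) * ((Real.cos (s * b) : ℂ) * cosTransform q b) := by
    ext b
    rw [oRangeSuperposition, integral_dirac, oRangeRadial, if_pos hr, hG, ← hsdef, mul_comm s b]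
    push_cast
    ring
  have hrs : √(s ^ 2 + R ^ 2) = r := by
    rw [hsdef, Real.sq_sqrt (by nlinarith), sub_add_cancel, Real.sqrt_sq (by linarith)]
  rw [hsup]
  refine ⟨((integrable_ofReal_cos_mul (integrable_cosTransform q).integrableOn s).const_mul _), ?_⟩
  have hinv := cosTransform_inversion q hs.le
  rw [hq, hrs] at hinv
  rw [integral_const_mul, div_mul_eq_mul_div, eq_div_iff hs', mul_comm, hinv]
  simp only [mul_comm s]

end Range

section Kernel

variable {R L M C : ℝ} {v : ℝ → ℝ → ℂ} {m : ℝ → ℝ}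

/-- The common form of the integrands of the even and the odd projections. -/
noncomputable def kernel (R L a c : ℝ) (m : ℝ → ℝ) (v : ℝ → ℝ → ℂ) (x r : ℝ) : ℂ :=
  (x : ℂ) * ((besselJ0 (a * √(x ^ 2 - L ^ 2)) : ℂ) * ((m x : ℂ) *
    (((Real.cos (c * √(R ^ 2 - r ^ 2)) * r : ℝ) : ℂ) * v x r)))

/-- On the strip, `x v(x,r)` is dominated by the integrable function `C/(1 + x²)`; the other factors
are bounded by `M R` since `|J₀| ≤ 1`. -/
theorem integrableOn_kernel (hv : Continuous fun p : ℝ × ℝ => v p.1 p.2)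
    (hC : ∀ x : ℝ, ∀ r ∈ Ioo 0 R, ‖(x : ℂ) * v x r‖ ≤ C * (1 + x ^ 2)⁻¹)
    (hm : ContinuousOn m (Ioi L)) (hM : ∀ x ∈ Ioi L, |m x| ≤ M) (a c : ℝ) :
    IntegrableOn (fun p : ℝ × ℝ => kernel R L a c m v p.1 p.2) (Ioi L ×ˢ Ioo 0 R) := by
  have hS : MeasurableSet (Ioi L ×ˢ Ioo 0 R) := measurableSet_Ioi.prod measurableSet_Ioo
  have h1 : IntegrableOn (fun p : ℝ × ℝ => (p.1 : ℂ) * v p.1 p.2) (Ioi L ×ˢ Ioo 0 R) := by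
    have hb : IntegrableOn (fun p : ℝ × ℝ => C * (1 + p.1 ^ 2)⁻¹ * 1) (Ioi L ×ˢ Ioo 0 R) := by
      have h2 : IntegrableOn (fun _ : ℝ => (1 : ℝ)) (Ioo 0 R) := by simp
      have h3 := Integrable.mul_prod (μ := volume.restrict (Ioi L))
        (ν := volume.restrict (Ioo 0 R)) (integrable_inv_one_add_sq.const_mul C).integrableOn h2
      rwa [Measure.prod_restrict] at h3
    refine Integrable.mono' hb (Continuous.aestronglyMeasurable (by fun_prop)) ?_
    refine (ae_restrict_iff' hS).2 (Filter.Eventually.of_forall fun p hp => ?_)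
    rw [mul_one]
    exact hC _ _ hp.2
  have hJ : Continuous fun p : ℝ × ℝ => besselJ0 (a * √(p.1 ^ 2 - L ^ 2)) :=
    continuous_besselJ0.comp (by fun_prop)
  have hk : ContinuousOn (fun p : ℝ × ℝ =>
      ((besselJ0 (a * √(p.1 ^ 2 - L ^ 2)) * m p.1 * (Real.cos (c * √(R ^ 2 - p.2 ^ 2)) * p.2) : ℝ) :
        ℂ)) (Ioi L ×ˢ Ioo 0 R) := by
    refine Complex.continuous_ofReal.comp_continuousOn ?_
    refine (hJ.continuousOn.mul (hm.comp continuousOn_fst fun p hp => hp.1)).mul ?_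
    exact Continuous.continuousOn (by fun_prop)
  have h4 := h1.bdd_mul (c := M * R) (hk.aestronglyMeasurable hS)
    ((ae_restrict_iff' hS).2 (Filter.Eventually.of_forall fun p hp => by
      have hp2 : |p.2| ≤ R := by
        rw [abs_of_pos hp.2.1]
        exact hp.2.2.le
      have hM0 : 0 ≤ M := (abs_nonneg _).trans (hM _ hp.1)
      rw [Complex.norm_real, Real.norm_eq_abs, abs_mul, abs_mul, abs_mul]
      calc _ ≤ 1 * M * (1 * R) := by
            gcongr
            · exact abs_besselJ0_le_one _
            · exact hM _ hp.1
            · exact Real.abs_cos_le_one _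
        _ = M * R := by ring))
  refine IntegrableOn.congr_fun h4 (fun p _ => ?_) hS
  simp only [kernel]
  push_cast
  ring

/-- Fubini brings the `r`-integral inside, where it is the cosine coefficient `D x`; the
substitution `x = √(y² + L²)` then turns the argument of `J₀` into `a y`. -/
theorem integral_kernel (hL : 0 < L) (hv : Continuous fun p : ℝ × ℝ => v p.1 p.2)
    (hC : ∀ x : ℝ, ∀ r ∈ Ioo 0 R, ‖(x : ℂ) * v x r‖ ≤ C * (1 + x ^ 2)⁻¹)
    (hm : ContinuousOn m (Ioi L)) (hM : ∀ x ∈ Ioi L, |m x| ≤ M) (a c : ℝ) {D : ℝ → ℂ}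
    (hD : ∀ x, D x = ∫ r in Ioo 0 R, ((Real.cos (c * √(R ^ 2 - r ^ 2)) * r : ℝ) : ℂ) * v x r) :
    ∫ r in Ioo 0 R, ∫ x in Ioi L, kernel R L a c m v x r =
      hankel (fun y => (m √(y ^ 2 + L ^ 2) : ℂ) * D √(y ^ 2 + L ^ 2)) a := by
  have hint := integrableOn_kernel hv hC hm hM a c
  rw [IntegrableOn, Measure.volume_eq_prod, ← Measure.prod_restrict] at hint
  rw [integral_integral_swap (f := fun r x => kernel R L a c m v x r) hint.swap]
  have h1 : ∀ x, ∫ r in Ioo 0 R, kernel R L a c m v x r =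
      (x : ℂ) * ((besselJ0 (a * √(x ^ 2 - L ^ 2)) : ℂ) * ((m x : ℂ) * D x)) := by
    intro x
    simp only [kernel, integral_const_mul, hD]
  simp only [h1]
  rw [integral_Ioi_sqrt_sub hL, hankel]
  refine setIntegral_congr_fun measurableSet_Ioi fun y hy => ?_
  rw [Real.sq_sqrt (by positivity), add_sub_cancel_right, Real.sqrt_sq (le_of_lt hy)]

end Kernel

/-- The expansion of one coefficient function by Hankel inversion. -/
theorem hankel_expansion {F : 𝓢(ℂ, ℂ)} {u : ℝ → ℂ}
    (hF : ∀ z : ℂ, F z = u ‖z‖) (hu : ∀ y : ℝ, u |y| = u y) {y : ℝ} (hy : 0 ≤ y) (κ ν : ℂ) :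
    IntegrableOn (fun a : ℝ => (κ * besselJ0 (a * y)) * (ν * a * hankel u a)) (Ioi 0) ∧
      ∫ a in Ioi (0 : ℝ), (κ * besselJ0 (a * y)) * (ν * a * hankel u a) = κ * ν * u y := by
  have hFr : ∀ z, F z = F (‖z‖ : ℂ) := fun z => by simp [hF]
  have hFu : (fun ρ : ℝ => F (ρ : ℂ)) = u := by
    ext ρ
    rw [hF, Complex.norm_real, Real.norm_eq_abs, hu]
  have e : ∀ a : ℝ, (κ * besselJ0 (a * y)) * (ν * a * hankel u a) =
      κ * ν * ((a : ℂ) * ((besselJ0 (y * a) : ℂ) * hankel u a)) := by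
    intro a
    rw [mul_comm a y]
    ring
  have h1 := integrableOn_hankel_inversion F hFr y
  have h2 := hankel_inversion F hFr hy
  rw [hFu] at h1 h2
  simp only [e]
  refine ⟨h1.const_mul _, ?_⟩
  rw [integral_const_mul, h2, hF, Complex.norm_real, Real.norm_of_nonneg hy]

/-- The cosine series in the radial variable. -/
theorem hasSum_radial_cosine_series {R : ℝ} (hR : 0 < R) {ψ : 𝓢(ℝ, ℂ)} (he : ∀ r, ψ (-r) = ψ r)
    {r : ℝ} (h0 : 0 < r) (hr : r < R) :
    HasSum (fun l : ℕ => ((Real.cos (l * (Real.pi / R) * √(R ^ 2 - r ^ 2)) / √(R ^ 2 - r ^ 2) : ℝ) :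
        ℂ) * ((neumannNumber l / (2 * R) : ℝ) : ℂ) *
      ∫ ρ in Ioo 0 R, ((Real.cos (l * (Real.pi / R) * √(R ^ 2 - ρ ^ 2)) * ρ : ℝ) : ℂ) * ψ ρ)
      (ψ r / 2) := by
  obtain ⟨C, hC⟩ := exists_bounded_deriv_mul_comp_sqrt (R := R) ψ he
  have ht0 : 0 < √(R ^ 2 - r ^ 2) := Real.sqrt_pos.2 (by nlinarith)
  have htR : √(R ^ 2 - r ^ 2) < R := by
    rw [Real.sqrt_lt' hR]
    nlinarith
  have htr : √(R ^ 2 - √(R ^ 2 - r ^ 2) ^ 2) = r := by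
    rw [Real.sq_sqrt (by nlinarith), sub_sub_cancel, Real.sqrt_sq h0.le]
  set t := √(R ^ 2 - r ^ 2) with ht
  have htc : (t : ℂ) ≠ 0 := by exact_mod_cast ht0.ne'
  have hRc : (R : ℂ) ≠ 0 := by exact_mod_cast hR.ne'
  have hs := hasSum_cosine_series hR (H := fun t : ℝ => (t : ℂ) * ψ √(R ^ 2 - t ^ 2))
    (Continuous.continuousOn (by fun_prop)) hC ⟨ht0.le, htR⟩
  rw [htr] at hs
  -- The series represents `t ψ(r)`. Dividing by `2t` yields the denominator of the kernel and
  -- changes the normalization `1/R` into the `1/(2R)` of the projections, hence the value `ψ(r)/2`.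
  have hs2 := hs.mul_left ((2 * t : ℂ)⁻¹)
  have e : (2 * t : ℂ)⁻¹ * (t * ψ r) = ψ r / 2 := by field_simp
  rw [e] at hs2
  refine hs2.congr_fun fun l => ?_
  have hsub := integral_Ioo_sqrt_sub hR
    (fun ρ => (Real.cos (l * (Real.pi / R) * √(R ^ 2 - ρ ^ 2)) : ℂ) * ψ ρ)
  have e1 : ∀ ρ : ℝ, ((Real.cos (l * (Real.pi / R) * √(R ^ 2 - ρ ^ 2)) * ρ : ℝ) : ℂ) * ψ ρ =
      (ρ : ℂ) * ((Real.cos (l * (Real.pi / R) * √(R ^ 2 - ρ ^ 2)) : ℂ) * ψ ρ) := by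
    intro ρ
    push_cast
    ring
  have e2 : ∀ s ∈ Ioo 0 R, (s : ℂ) * ((Real.cos (l * (Real.pi / R) *
      √(R ^ 2 - √(R ^ 2 - s ^ 2) ^ 2)) : ℂ) * ψ √(R ^ 2 - s ^ 2)) =
      (Real.cos (l * (Real.pi / R) * s) : ℂ) * ((s : ℂ) * ψ √(R ^ 2 - s ^ 2)) := by
    rintro s ⟨hs0, hs1⟩
    rw [Real.sq_sqrt (by nlinarith), sub_sub_cancel, Real.sqrt_sq hs0.le]
    ring
  simp only [e1]
  rw [hsub, setIntegral_congr_fun measurableSet_Ioo e2]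
  push_cast
  field_simp

section Symmetrized

variable (f : SchwartzMap (EuclideanSpace ℝ (Fin 2)) ℂ)

/-- The combination `g(x,r) + σ g(-x,r)` of the spherical Radon transform `g`. -/
noncomputable def symRadon (σ : ℂ) (x r : ℝ) : ℂ :=
  sphericalRadon f x r + σ * sphericalRadon f (-x) r

theorem continuous_symRadon (σ : ℂ) : Continuous fun p : ℝ × ℝ => symRadon f σ p.1 p.2 := by
  have h := continuous_sphericalRadon f
  have h' : Continuous fun p : ℝ × ℝ => sphericalRadon f (-p.1) p.2 :=
    h.comp (f := fun p : ℝ × ℝ => (-p.1, p.2)) (by fun_prop)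
  exact h.add (continuous_const.mul h')

theorem symRadon_decay (σ : ℂ) (R : ℝ) : ∃ C, ∀ x : ℝ, ∀ r ∈ Ioo 0 R,
    ‖(x : ℂ) * symRadon f σ x r‖ ≤ C * (1 + x ^ 2)⁻¹ := by
  obtain ⟨C, hC⟩ := sphericalRadon_decay f R
  refine ⟨C + ‖σ‖ * C, fun x r hr => ?_⟩
  have h1 := hC x r hr
  have h2 := hC (-x) r hr
  rw [neg_sq, Complex.ofReal_neg, neg_mul, norm_neg] at h2
  have e : (x : ℂ) * symRadon f σ x r =
      x * sphericalRadon f x r + σ * (x * sphericalRadon f (-x) r) := by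
    rw [symRadon]; ring
  rw [e, add_mul, mul_assoc]
  refine (norm_add_le _ _).trans ?_
  rw [norm_mul σ]
  gcongr

theorem exists_schwartz_symRadon (σ : ℂ) (x : ℝ) :
    ∃ ψ : 𝓢(ℝ, ℂ), (∀ r, ψ r = symRadon f σ x r) ∧ ∀ r, ψ (-r) = ψ r := by
  obtain ⟨Φ, hΦ⟩ := exists_schwartz_sphericalRadon f x
  obtain ⟨Ψ, hΨ⟩ := exists_schwartz_sphericalRadon f (-x)
  have h : ∀ r, (Φ + σ • Ψ) r = symRadon f σ x r := fun r => by
    rw [add_apply, smul_apply, hΦ, hΨ, symRadon, smul_eq_mul]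
  refine ⟨Φ + σ • Ψ, h, fun r => ?_⟩
  rw [h, h, symRadon, symRadon, sphericalRadon_neg, sphericalRadon_neg]

theorem exists_schwartz_integral_symRadon (σ : ℂ) {R M : ℝ} {w : ℝ → ℝ} (hw : Continuous w)
    (hM : ∀ r ∈ Ioo 0 R, |w r| ≤ M) :
    ∃ D : 𝓢(ℝ, ℂ), ∀ x, D x = ∫ r in Ioo 0 R, (w r : ℂ) * symRadon f σ x r := by
  obtain ⟨Φ, hΦ⟩ := exists_schwartz_integral_sphericalRadon f hw hM
  refine ⟨Φ + σ • SchwartzMap.compCLMOfContinuousLinearEquiv ℂ (ContinuousLinearEquiv.neg ℝ) Φ,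
    fun x => ?_⟩
  have hi : ∀ x, IntegrableOn (fun r => (w r : ℂ) * sphericalRadon f x r) (Ioo 0 R) := by
    intro x
    have h : Continuous fun r => sphericalRadon f x r :=
      (continuous_sphericalRadon f).comp (f := fun r => (x, r)) (by fun_prop)
    have h' : Continuous fun r => (w r : ℂ) * sphericalRadon f x r := by fun_prop
    exact (h'.continuousOn.integrableOn_Icc).mono_set Ioo_subset_Icc_self
  rw [add_apply, smul_apply, SchwartzMap.compCLMOfContinuousLinearEquiv_apply]
  simp only [Function.comp_apply, ContinuousLinearEquiv.coe_neg, hΦ]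
  rw [smul_eq_mul, Pi.neg_apply, id, ← integral_const_mul,
    ← integral_add (hi x) ((hi (-x)).const_mul σ)]
  congr 1
  ext r
  rw [symRadon]
  ring

end Symmetrized

end SAR

/-! ### Even and odd reconstruction -/

namespace SAR

open scoped SchwartzMap Topology FourierTransform

section Reconstruction

variable (f : SchwartzMap (EuclideanSpace ℝ (Fin 2)) ℂ) {R L : ℝ}

theorem oEvenInnerIntegrand_eq (hR : 0 < R) (a : ℝ) (l : ℕ) (v : ℝ → ℝ → ℂ) {x r : ℝ}
    (hx : x ∈ Ioi L) (hr : r ∈ Ioo 0 R) :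
    oEvenInnerIntegrand R (oEven R L a l) v x r =
      kernel R L a (l * (Real.pi / R)) (fun _ => 1) v x r := by
  have hs : 0 < √(R ^ 2 - r ^ 2) := Real.sqrt_pos.2 (by nlinarith [hr.1, hr.2])
  have hs' : ((√(R ^ 2 - r ^ 2) : ℝ) : ℂ) ≠ 0 := by exact_mod_cast hs.ne'
  have hx' : L < |x| := lt_of_lt_of_le hx (le_abs_self x)
  rw [oEvenInnerIntegrand, oEven, if_pos ⟨⟨hr.1.le, hr.2⟩, hx'⟩, kernel]
  push_cast
  field_simp

theorem oOddInnerIntegrand_eq (hR : 0 < R) (hL : 0 < L) (a : ℝ) (l : ℕ) (v : ℝ → ℝ → ℂ) {x r : ℝ}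
    (hx : x ∈ Ioi L) (hr : r ∈ Ioo 0 R) :
    oOddInnerIntegrand R (oOdd R L a l) v x r =
      kernel R L a (l * (Real.pi / R)) (fun x => x⁻¹) v x r := by
  have hs : 0 < √(R ^ 2 - r ^ 2) := Real.sqrt_pos.2 (by nlinarith [hr.1, hr.2])
  have hs' : ((√(R ^ 2 - r ^ 2) : ℝ) : ℂ) ≠ 0 := by exact_mod_cast hs.ne'
  have hx' : L < |x| := lt_of_lt_of_le hx (le_abs_self x)
  have hxc : (x : ℂ) ≠ 0 := by exact_mod_cast (hL.trans hx).ne'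
  rw [oOddInnerIntegrand, oOdd, if_pos ⟨⟨hr.1.le, hr.2⟩, hx'⟩, kernel]
  push_cast
  field_simp

theorem continuousOn_inv_Ioi (hL : 0 < L) : ContinuousOn (fun x : ℝ => x⁻¹) (Ioi L) :=
  continuousOn_inv₀.mono fun _ hx => (hL.trans hx).ne'

theorem abs_inv_le_of_mem_Ioi (hL : 0 < L) : ∀ x ∈ Ioi L, |x⁻¹| ≤ L⁻¹ := fun x hx => by
  rw [abs_of_pos (inv_pos.2 (hL.trans hx))]
  exact inv_anti₀ hL (le_of_lt hx)

theorem integrableOn_oEvenInnerIntegrand (hR : 0 < R) (L : ℝ) (σ : ℂ) (l : ℕ) (a : ℝ) :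
    IntegrableOn (fun p : ℝ × ℝ =>
      oEvenInnerIntegrand R (oEven R L a l) (symRadon f σ) p.1 p.2) (Ioi L ×ˢ Ioo 0 R) := by
  obtain ⟨C, hC⟩ := symRadon_decay f σ R
  refine IntegrableOn.congr_fun (integrableOn_kernel (continuous_symRadon f σ) hC
    (continuousOn_const (c := (1 : ℝ))) (M := 1) (fun x _ => by simp) a (l * (Real.pi / R)))
    (fun p hp => ?_) (measurableSet_Ioi.prod measurableSet_Ioo)
  exact (oEvenInnerIntegrand_eq hR a l _ hp.1 hp.2).symm

theorem integrableOn_oOddInnerIntegrand (hR : 0 < R) (hL : 0 < L) (σ : ℂ) (l : ℕ) (a : ℝ) :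
    IntegrableOn (fun p : ℝ × ℝ =>
      oOddInnerIntegrand R (oOdd R L a l) (symRadon f σ) p.1 p.2) (Ioi L ×ˢ Ioo 0 R) := by
  obtain ⟨C, hC⟩ := symRadon_decay f σ R
  refine IntegrableOn.congr_fun (integrableOn_kernel (continuous_symRadon f σ) hC
    (continuousOn_inv_Ioi hL) (abs_inv_le_of_mem_Ioi hL) a (l * (Real.pi / R)))
    (fun p hp => ?_) (measurableSet_Ioi.prod measurableSet_Ioo)
  exact (oOddInnerIntegrand_eq hR hL a l _ hp.1 hp.2).symm

theorem exists_schwartz_cosine_coefficient (R : ℝ) (σ : ℂ) (c : ℝ) :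
    ∃ D : 𝓢(ℝ, ℂ), ∀ x, D x =
      ∫ r in Ioo 0 R, ((Real.cos (c * √(R ^ 2 - r ^ 2)) * r : ℝ) : ℂ) * symRadon f σ x r := by
  refine exists_schwartz_integral_symRadon f σ (M := 1 * R) (by fun_prop) fun r hr => ?_
  rw [abs_mul, abs_of_pos hr.1]
  exact mul_le_mul (Real.abs_cos_le_one _) hr.2.le hr.1.le zero_le_one

theorem sqrt_sq_sub_add_sq (hL : 0 < L) {x : ℝ} (hx : L < |x|) :
    √(√(x ^ 2 - L ^ 2) ^ 2 + L ^ 2) = |x| := by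
  have h : L ^ 2 ≤ x ^ 2 := by
    rw [← sq_abs x]
    exact pow_le_pow_left₀ hL.le hx.le 2
  rw [Real.sq_sqrt (by linarith), sub_add_cancel, Real.sqrt_sq_eq_abs]

/-- The coefficients inherit the parity `σ` of the symmetrized data. Hankel inversion only returns
values at `|x|`, so this is what reaches `x < -L`. -/
theorem integral_symRadon_neg {w : ℝ → ℂ} {s : Set ℝ} {σ : ℂ} (hσ : σ * σ = 1) {D : ℝ → ℂ}
    (hD : ∀ x, D x = ∫ r in s, w r * symRadon f σ x r) (x : ℝ) : D (-x) = σ * D x := by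
  rw [hD, hD, ← integral_const_mul]
  congr 1
  ext r
  rw [symRadon, symRadon, neg_neg]
  linear_combination (-(w r * sphericalRadon f (-x) r)) * hσ

theorem even_expansion (hR : 0 < R) (hL : 0 < L) {v : ℝ → ℝ → ℂ} (hv : v = symRadon f 1)
    {g : ℝ → ℝ → ℂ} (hg : v = fun x r => g x r + g (-x) r) {x r : ℝ} (h0 : 0 < r) (hr : r < R)
    (hx : L < |x|) :
    (∀ l : ℕ, IntegrableOn (fun a : ℝ => (oEven R L a l x r : ℂ) * GEven R L g l a) (Ioi 0)) ∧
      HasSum (fun l : ℕ => ∫ a in Ioi (0 : ℝ), (oEven R L a l x r : ℂ) * GEven R L g l a)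
        (v x r / 2) := by
  have key : ∀ l : ℕ,
      IntegrableOn (fun a : ℝ => (oEven R L a l x r : ℂ) * GEven R L g l a) (Ioi 0) ∧
      ∫ a in Ioi (0 : ℝ), (oEven R L a l x r : ℂ) * GEven R L g l a =
        ((Real.cos (l * (Real.pi / R) * √(R ^ 2 - r ^ 2)) / √(R ^ 2 - r ^ 2) : ℝ) : ℂ) *
        ((neumannNumber l / (2 * R) : ℝ) : ℂ) *
        ∫ ρ in Ioo 0 R, ((Real.cos (l * (Real.pi / R) * √(R ^ 2 - ρ ^ 2)) * ρ : ℝ) : ℂ) *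
          symRadon f 1 x ρ := by
    intro l
    obtain ⟨D, hD⟩ := exists_schwartz_cosine_coefficient f R 1 (l * (Real.pi / R))
    obtain ⟨C, hC⟩ := symRadon_decay f 1 R
    -- The factor `1` matches the multiplier `m = 1` in `integral_kernel`.
    set u : ℝ → ℂ := fun y => ((1 : ℝ) : ℂ) * D √(y ^ 2 + L ^ 2) with hu
    have hG : ∀ a, GEven R L g l a = ((neumannNumber l / (2 * R) : ℝ) : ℂ) * a * hankel u a := by
      intro a
      have hin : oEvenInner R L (oEven R L a l) v = hankel u a := by
        rw [hu, ← integral_kernel hL (continuous_symRadon f 1) hC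
          (continuousOn_const (c := (1 : ℝ))) (M := 1) (fun x _ => by simp) a _ hD, oEvenInner, hv]
        refine setIntegral_congr_fun measurableSet_Ioo fun ρ hρ => ?_
        refine setIntegral_congr_fun measurableSet_Ioi fun ξ hξ => ?_
        exact oEvenInnerIntegrand_eq hR a l _ hξ hρ
      rw [GEven, ← hg, hin]
      push_cast
      ring
    have ho : ∀ a, (oEven R L a l x r : ℂ) =
        ((Real.cos (l * (Real.pi / R) * √(R ^ 2 - r ^ 2)) / √(R ^ 2 - r ^ 2) : ℝ) : ℂ) *
          besselJ0 (a * √(x ^ 2 - L ^ 2)) := by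
      intro a
      rw [oEven, if_pos ⟨⟨h0.le, hr⟩, hx⟩]
      push_cast
      ring
    have hexp := hankel_expansion (F := radialLift hL D) (u := u)
      (fun z => by simp only [radialLift_apply, hu, Complex.ofReal_one, one_mul])
      (fun y => by simp only [hu, sq_abs]) (Real.sqrt_nonneg (x ^ 2 - L ^ 2))
      ((Real.cos (l * (Real.pi / R) * √(R ^ 2 - r ^ 2)) / √(R ^ 2 - r ^ 2) : ℝ) : ℂ)
      ((neumannNumber l / (2 * R) : ℝ) : ℂ)
    have hval : u √(x ^ 2 - L ^ 2) = D x := by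
      simp only [hu]
      rw [sqrt_sq_sub_add_sq hL hx, Complex.ofReal_one, one_mul]
      have h1 := integral_symRadon_neg f (one_mul 1) hD x
      rcases abs_choice x with h | h <;> rw [h]
      rw [h1, one_mul]
    rw [hval, hD] at hexp
    simp only [hG, ho]
    exact hexp
  refine ⟨fun l => (key l).1, ?_⟩
  obtain ⟨ψ, hψ, he⟩ := exists_schwartz_symRadon f 1 x
  have hs := hasSum_radial_cosine_series hR he h0 hr
  simp only [hψ] at hs
  rw [hv]
  exact hs.congr_fun fun l => (key l).2

theorem odd_expansion (hR : 0 < R) (hL : 0 < L) {v : ℝ → ℝ → ℂ} (hv : v = symRadon f (-1))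
    {g : ℝ → ℝ → ℂ} (hg : v = fun x r => g x r - g (-x) r) {x r : ℝ} (h0 : 0 < r) (hr : r < R)
    (hx : L < |x|) :
    (∀ l : ℕ, IntegrableOn (fun a : ℝ => (oOdd R L a l x r : ℂ) * GOdd R L g l a) (Ioi 0)) ∧
      HasSum (fun l : ℕ => ∫ a in Ioi (0 : ℝ), (oOdd R L a l x r : ℂ) * GOdd R L g l a)
        (v x r / 2) := by
  have key : ∀ l : ℕ,
      IntegrableOn (fun a : ℝ => (oOdd R L a l x r : ℂ) * GOdd R L g l a) (Ioi 0) ∧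
      ∫ a in Ioi (0 : ℝ), (oOdd R L a l x r : ℂ) * GOdd R L g l a =
        ((Real.cos (l * (Real.pi / R) * √(R ^ 2 - r ^ 2)) / √(R ^ 2 - r ^ 2) : ℝ) : ℂ) *
        ((neumannNumber l / (2 * R) : ℝ) : ℂ) *
        ∫ ρ in Ioo 0 R, ((Real.cos (l * (Real.pi / R) * √(R ^ 2 - ρ ^ 2)) * ρ : ℝ) : ℂ) *
          symRadon f (-1) x ρ := by
    intro l
    obtain ⟨D, hD⟩ := exists_schwartz_cosine_coefficient f R (-1) (l * (Real.pi / R))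
    obtain ⟨C, hC⟩ := symRadon_decay f (-1) R
    -- In the odd pairing the factor `x` of the kernel cancels the weight `1/x`. Relative to the
    -- Jacobian factor `x` of the substitution, a multiplier `1/x` is left over.
    set u : ℝ → ℂ := fun y => (((√(y ^ 2 + L ^ 2))⁻¹ : ℝ) : ℂ) * D √(y ^ 2 + L ^ 2) with hu
    have hG : ∀ a, GOdd R L g l a = ((neumannNumber l / (2 * R) : ℝ) : ℂ) * a * hankel u a := by
      intro a
      have hin : oOddInner R L (oOdd R L a l) v = hankel u a := by
        rw [hu, ← integral_kernel hL (continuous_symRadon f (-1)) hC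
          (continuousOn_inv_Ioi hL) (abs_inv_le_of_mem_Ioi hL) a _ hD, oOddInner, hv]
        refine setIntegral_congr_fun measurableSet_Ioo fun ρ hρ => ?_
        refine setIntegral_congr_fun measurableSet_Ioi fun ξ hξ => ?_
        exact oOddInnerIntegrand_eq hR hL a l _ hξ hρ
      rw [GOdd, ← hg, hin]
      push_cast
      ring
    have ho : ∀ a, (oOdd R L a l x r : ℂ) =
        (x * ((Real.cos (l * (Real.pi / R) * √(R ^ 2 - r ^ 2)) / √(R ^ 2 - r ^ 2) : ℝ) : ℂ)) *
          besselJ0 (a * √(x ^ 2 - L ^ 2)) := by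
      intro a
      rw [oOdd, if_pos ⟨⟨h0.le, hr⟩, hx⟩]
      push_cast
      ring
    have hexp := hankel_expansion (F := radialLiftDiv hL D) (u := u)
      (fun z => by simp only [radialLiftDiv_apply, hu])
      (fun y => by simp only [hu, sq_abs]) (Real.sqrt_nonneg (x ^ 2 - L ^ 2))
      (x * ((Real.cos (l * (Real.pi / R) * √(R ^ 2 - r ^ 2)) / √(R ^ 2 - r ^ 2) : ℝ) : ℂ))
      ((neumannNumber l / (2 * R) : ℝ) : ℂ)
    have hx0 : (x : ℂ) ≠ 0 := by
      have : x ≠ 0 := abs_pos.1 (hL.trans hx)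
      exact_mod_cast this
    -- For negative `x` the sign of `x/|x|` is compensated by the oddness of `D`.
    have hval : x * u √(x ^ 2 - L ^ 2) = D x := by
      simp only [hu]
      rw [sqrt_sq_sub_add_sq hL hx]
      have h1 := integral_symRadon_neg f (by norm_num) hD x
      rcases abs_choice x with h | h <;> rw [h]
      · rw [Complex.ofReal_inv, mul_inv_cancel_left₀ hx0]
      · rw [h1, Complex.ofReal_inv, Complex.ofReal_neg]
        field_simp
    simp only [hG, ho]
    refine ⟨hexp.1, hexp.2.trans ?_⟩
    rw [← hD, ← hval]
    ring
  refine ⟨fun l => (key l).1, ?_⟩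
  obtain ⟨ψ, hψ, he⟩ := exists_schwartz_symRadon f (-1) x
  have hs := hasSum_radial_cosine_series hR he h0 hr
  simp only [hψ] at hs
  rw [hv]
  exact hs.congr_fun fun l => (key l).2

end Reconstruction

end SAR

/-- `HasSum` over the complex numbers is unconditional summation and therefore includes the absolute
convergence of the series; `IntegrableOn` does the same for the integrals. -/
theorem mainTheorem3 (R L : ℝ) (hR : 0 < R) (hL : 0 < L)
    (f : SchwartzMap (EuclideanSpace ℝ (Fin 2)) ℂ) (g : ℝ → ℝ → ℂ)
    (hg : g = SAR.sphericalRadon f) :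
    -- the range part
    ((∀ a b : ℝ, 0 ≤ b →
        IntegrableOn (SAR.oRangeInnerIntegrand R a b g) (Ioi R)) ∧
      (∀ x r : ℝ, R < r →
        IntegrableOn (SAR.oRangeSuperposition R (SAR.GRange R g) x r) (Ioi 0) ∧
        g x r = ∫ b in Ioi (0 : ℝ), SAR.oRangeSuperposition R (SAR.GRange R g) x r b)) ∧
    -- the even part
    ((∀ (l : ℕ) (a : ℝ), 0 ≤ a →
        IntegrableOn (fun p : ℝ × ℝ =>
          SAR.oEvenInnerIntegrand R (SAR.oEven R L a l) (fun x r => g x r + g (-x) r) p.1 p.2)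
          (Ioi L ×ˢ Ioo 0 R)) ∧
      (∀ x r : ℝ, 0 < r → r < R → L < |x| →
        (∀ l : ℕ, IntegrableOn
          (fun a : ℝ => (SAR.oEven R L a l x r : ℂ) * SAR.GEven R L g l a) (Ioi 0)) ∧
        HasSum (fun l : ℕ =>
            ∫ a in Ioi (0 : ℝ), (SAR.oEven R L a l x r : ℂ) * SAR.GEven R L g l a)
          ((g x r + g (-x) r) / 2) ∧
        ((∀ x' r' : ℝ, g (-x') r' = g x' r') →
          HasSum (fun l : ℕ =>
            ∫ a in Ioi (0 : ℝ), (SAR.oEven R L a l x r : ℂ) * SAR.GEven R L g l a) (g x r)))) ∧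
    -- the odd part
    ((∀ (l : ℕ) (a : ℝ), 0 ≤ a →
        IntegrableOn (fun p : ℝ × ℝ =>
          SAR.oOddInnerIntegrand R (SAR.oOdd R L a l) (fun x r => g x r - g (-x) r) p.1 p.2)
          (Ioi L ×ˢ Ioo 0 R)) ∧
      (∀ x r : ℝ, 0 < r → r < R → L < |x| →
        (∀ l : ℕ, IntegrableOn
          (fun a : ℝ => (SAR.oOdd R L a l x r : ℂ) * SAR.GOdd R L g l a) (Ioi 0)) ∧
        HasSum (fun l : ℕ =>
            ∫ a in Ioi (0 : ℝ), (SAR.oOdd R L a l x r : ℂ) * SAR.GOdd R L g l a)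
          ((g x r - g (-x) r) / 2) ∧
        ((∀ x' r' : ℝ, g (-x') r' = -g x' r') →
          HasSum (fun l : ℕ =>
            ∫ a in Ioi (0 : ℝ), (SAR.oOdd R L a l x r : ℂ) * SAR.GOdd R L g l a) (g x r)))) := by
  have he : (fun x r => g x r + g (-x) r) = SAR.symRadon f 1 := by
    ext x r
    rw [hg, SAR.symRadon, one_mul]
  have ho : (fun x r => g x r - g (-x) r) = SAR.symRadon f (-1) := by
    ext x r
    rw [hg, SAR.symRadon, neg_one_mul, sub_eq_add_neg]
  refine ⟨⟨fun a b _ => ?_, fun x r hr => ?_⟩, ⟨fun l a _ => ?_, fun x r h0 hr hx => ?_⟩,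
    ⟨fun l a _ => ?_, fun x r h0 hr hx => ?_⟩⟩
  · rw [hg]
    exact SAR.integrableOn_oRangeInnerIntegrand f hR a b
  · rw [hg]
    exact SAR.oRange_reconstruction f hR hr
  · rw [he]
    exact SAR.integrableOn_oEvenInnerIntegrand f hR L 1 l a
  · obtain ⟨h1, h2⟩ := SAR.even_expansion f hR hL he rfl h0 hr hx
    refine ⟨h1, h2, fun hsym => ?_⟩
    have e : (g x r + g (-x) r) / 2 = g x r := by rw [hsym]; ring
    rwa [e] at h2
  · rw [ho]
    exact SAR.integrableOn_oOddInnerIntegrand f hR hL (-1) l a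
  · obtain ⟨h1, h2⟩ := SAR.odd_expansion f hR hL ho rfl h0 hr hx
    refine ⟨h1, h2, fun hsym => ?_⟩
    have e : (g x r - g (-x) r) / 2 = g x r := by rw [hsym]; ring
    rwa [e] at h2
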